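/- Let $n\ge 1$ and $\mathbb N_0=\{0,1,2,\dots\}$; for $\xi\in\mathbb N_0^n$ put $|\xi|=\xi_1+\dots+\xi_n$ and $\langle\xi\rangle=1+|\xi|$. Let $h_\xi(x)=\prod_{j=1}^n h_{\xi_j}(x_j)$ be the Hermite functions on $\mathbb R^n$, where $h_k(t)=(2^kk!\sqrt\pi)^{-1/2}H_k(t)e^{-t^2/2}$ and $H_k(t)=(-1)^ke^{t^2}\partial_t^k(e^{-t^2})$. They form an orthonormal basis of $L^2(\mathbb R^n)$ consisting of eigenfunctions of $\mathcal L=-\Delta+|x|^2$. For $\sigma:\mathbb R^n\times\mathbb N_0^n\to\mathbb C$ the Hermite pseudo-multiplier $\sigma(\cdot,\mathcal L)$ is $$\sigma(x,\mathcal L)f(x)=\sum_{\xi\in\mathbb N_0^n}\sigma(x,\xi)\,\langle f,h_\xi\rangle\,h_\xi(x),\qquad \langle f,h_\xi\rangle=\int_{\mathbb R^n}f\,h_\xi\,dx .$$ Write $\triangle_\xi^\kappa=\triangle_1^{\kappa_1}\cdots\triangle_n^{\kappa_n}$ with $\triangle_i g(\xi)=g(\xi+e_i)-g(\xi)$. **Theorem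 1.2.** Let $0\le\delta<1$, $\mathcal K=\lfloor n/2\rfloor+1$ and $\mathcal N=\left\lfloor\frac{2n}{1-\delta}\right\rfloor+1$. Suppose that $\sigma\in S^{0,\mathcal K,\mathcal N}_{1,\delta}$, that is, $\sigma(\cdot,\xi)\in C^{\mathcal N}(\mathbb R^n)$ for each $\xi\in\mathbb N_0^n$, and for all $\nu,\kappa\in\mathbb N_0^n$ with $|\nu|\le\mathcal N$ and $|\kappa|\le\mathcal K$ there is a constant $C_{\nu,\kappa}>0$ such that $$|\partial_x^\nu\triangle_\xi^\kappa\sigma(x,\xi)|\le C_{\nu,\kappa}\,\langle\xi\rangle^{-|\kappa|+\frac{\delta}{2}|\nu|}\qquad\text{for all }(x,\xi)\in\mathbb R^n\times\mathbb N_0^n .$$ Then $\sigma(\cdot,\mathcal L)$ extends to a bounded operator on $L^2(\mathbb R^n)$: there is a bounded linear operator $T$ on $L^2(\mathbb R^n)$ such that for every $f\in L^2(\mathbb R^n)$ the series defining $\sigma(\cdot,\mathcal L)f$ converges unconditionally in $L^2(\mathbb R^n)$ to $Tf$, and $Tf(x)=\sigma(x,\mathcal L)f(x)$ for almost every $x$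 whenever that series converges absolutely at almost every $x$. -/

import Mathlib

open MeasureTheory Filter Topology
open scoped ENNReal

noncomputable section

namespace HermitePM

/-- `ℝⁿ` with its Euclidean norm and Lebesgue measure. -/
abbrev Rn (n : ℕ) : Type := EuclideanSpace ℝ (Fin n)

/-- Multi-indices, the elements of `ℕ₀ⁿ`. -/
abbrev MIdx (n : ℕ) : Type := Fin n → ℕ

/-- The length `|ξ| = ξ₁ + ⋯ + ξₙ` of a multi-index. -/
def MIdx.len {n : ℕ} (ξ : MIdx n) : ℕ := ∑ i, ξ i

/-- The (physicists') Hermite polynomial `H_k(t) = (-1)^k e^{t²} ∂_t^k (e^{-t²})`. -/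
def hermiteH (k : ℕ) (t : ℝ) : ℝ :=
  (-1) ^ k * Real.exp (t ^ 2) * iteratedDeriv k (fun s : ℝ => Real.exp (-s ^ 2)) t

/-- The Hermite function `h_k(t) = (2^k k! √π)^{-1/2} H_k(t) e^{-t²/2}` on `ℝ`. -/
def hermiteFun1 (k : ℕ) (t : ℝ) : ℝ :=
  (Real.sqrt (2 ^ k * (k.factorial : ℝ) * Real.sqrt Real.pi))⁻¹ *
    hermiteH k t * Real.exp (-t ^ 2 / 2)

/-- The `n`-dimensional Hermite function `h_ξ(x) = ∏ⱼ h_{ξⱼ}(xⱼ)`. -/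
def hermiteFun {n : ℕ} (ξ : MIdx n) (x : Rn n) : ℝ :=
  ∏ j, hermiteFun1 (ξ j) (x j)

/-- The Hermite coefficient `⟨f, h_ξ⟩ = ∫ f h_ξ dx` (the functions `h_ξ` are real-valued). -/
def hermiteCoeff {n : ℕ} (f : Rn n → ℂ) (ξ : MIdx n) : ℂ :=
  ∫ x, f x * (hermiteFun ξ x : ℂ)

/-- The term of index `ξ` in the expansion that defines the pseudo-multiplier with symbol `σ`:
`σ(x, ξ) ⟨f, h_ξ⟩ h_ξ(x)`. -/
def pseudoMultTerm {n : ℕ} (σ : Rn n → MIdx n → ℂ) (f : Rn n → ℂ) (ξ : MIdx n) (x : Rn n) : ℂ :=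
  σ x ξ * hermiteCoeff f ξ * (hermiteFun ξ x : ℂ)

/-- The Hermite pseudo-multiplier
`σ(x, 𝓛) f(x) = ∑_ξ σ(x, ξ) ⟨f, h_ξ⟩ h_ξ(x)`, `𝓛 = -Δ + |x|²`, as a pointwise sum. -/
def pseudoMult {n : ℕ} (σ : Rn n → MIdx n → ℂ) (f : Rn n → ℂ) (x : Rn n) : ℂ :=
  ∑' ξ : MIdx n, pseudoMultTerm σ f ξ x

/-- The partial derivative `∂f/∂xᵢ`. -/
def partialDeriv {n : ℕ} (i : Fin n) (f : Rn n → ℂ) : Rn n → ℂ :=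
  fun x => fderiv ℝ f x (EuclideanSpace.single i 1)

/-- The derivative `∂^ν = ∂₁^{ν₁} ⋯ ∂ₙ^{νₙ}`. -/
def multiDeriv {n : ℕ} (ν : MIdx n) (f : Rn n → ℂ) : Rn n → ℂ :=
  (List.finRange n).foldr (fun i g => (partialDeriv i)^[ν i] g) f

/-- The forward difference `△ᵢ g(ξ) = g(ξ + eᵢ) - g(ξ)`. -/
def partialDiff {n : ℕ} (i : Fin n) (g : MIdx n → ℂ) : MIdx n → ℂ :=
  fun ξ => g (ξ + Pi.single i 1) - g ξ

/-- The difference operator `△^κ = △₁^{κ₁} ⋯ △ₙ^{κₙ}`. -/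
def multiDiff {n : ℕ} (κ : MIdx n) (g : MIdx n → ℂ) : MIdx n → ℂ :=
  (List.finRange n).foldr (fun i g => (partialDiff i)^[κ i] g) g

/-- The symbol class `S^{m,K,N}_{ρ,δ}`: each `σ(·, ξ)` is of class `C^N`, and
`|∂_x^ν △_ξ^κ σ(x, ξ)| ≤ C_{ν,κ} ⟨ξ⟩^{m/2 - ρ|κ| + (δ/2)|ν|}` for all `x`, `ξ` and all
`|κ| ≤ K`, `|ν| ≤ N`, where `⟨ξ⟩ = 1 + |ξ|`. -/
structure IsSymbol {n : ℕ} (m ρ δ : ℝ) (K N : ℕ∞) (σ : Rn n → MIdx n → ℂ) : Prop where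
  contDiff : ∀ ξ, ContDiff ℝ (N : WithTop ℕ∞) (fun x => σ x ξ)
  bound : ∀ ν κ : MIdx n, (ν.len : ℕ∞) ≤ N → (κ.len : ℕ∞) ≤ K →
    ∃ C : ℝ, 0 < C ∧ ∀ (x : Rn n) (ξ : MIdx n),
      ‖multiDeriv ν (fun y => multiDiff κ (σ y) ξ) x‖ ≤
        C * (1 + (ξ.len : ℝ)) ^ (m / 2 - ρ * (κ.len : ℝ) + δ / 2 * (ν.len : ℝ))

/-- `σ(·, 𝓛)` extends to a bounded operator on `L²(ℝⁿ)`: there is a bounded linear `T` on `L²`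
such that, for every `f ∈ L²`, the defining series of `σ(·, 𝓛) f` converges to `T f`
(unconditionally) in `L²`, and `T f` is the pointwise sum of that series almost everywhere
whenever the series converges absolutely almost everywhere. -/
def ExtendsBoundedlyL2 {n : ℕ} (σ : Rn n → MIdx n → ℂ) : Prop :=
  ∃ T : Lp ℂ 2 (volume : Measure (Rn n)) →L[ℂ] Lp ℂ 2 (volume : Measure (Rn n)),
    ∀ f : Lp ℂ 2 (volume : Measure (Rn n)),
      Tendsto (fun s : Finset (MIdx n) =>
        eLpNorm (fun x => T f x - ∑ ξ ∈ s, pseudoMultTerm σ f ξ x) 2 volume) atTop (𝓝 0) ∧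
      ((∀ᵐ x, Summable fun ξ : MIdx n => pseudoMultTerm σ f ξ x) →
        ∀ᵐ x, T f x = pseudoMult σ f x)

end HermitePM

end

/-!
Write `v_ξ = σ(·, ξ) h_ξ`. By Bessel's inequality for the Hermite functions, everything follows from
a Bessel inequality `‖∑ c_ξ v_ξ‖² ≤ C ∑ |c_ξ|²` for finite sums: it makes `∑ ⟨f, h_ξ⟩ v_ξ` converge
unconditionally for every `f ∈ L²` (`extendsBoundedlyL2_of_sum_le`). That inequality is proved by
splitting the sum with smooth cutoffs to the dyadic shells `⟨ξ⟩ ∼ 2^j`.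

*One shell* (`exists_block_bound`). At frequency scale `L` the operator has the kernel
`k(x, y) = ∑ τ(x, ξ) h_ξ(x) h_ξ(y)`. Multiplication by `xᵢ - yᵢ` commutes with the difference
`A_y - A_x` of the raising operators up to the scalar `-2`, so that by summation by parts it acts on
such kernels as a difference operator on `τ` followed by `A_y - A_x`, up to a term of lower order
(`sub_mul_kernelSum`). With `K > n/2` differences, Parseval's identity in `y` and the pointwise
bound `∑_{k ≤ m} h_k(t)² ≤ √(2(m+1))` (`sum_sq_hermiteE1_le`), the function `k(x, ·)` is square
integrable against the weight `1 + ∑ᵢ (√L (xᵢ - yᵢ))^{2K}`, with a bound that is uniform in `x`. The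
inverse of the weight is integrable, and the weighted Cauchy–Schwarz inequality gives a bound on
`L²` that does not depend on `L`. Regularity of the symbol in `x` plays no role here.

*Two distant shells* (`exists_gram_decay`). The Wronskian of `h_ξ` and `h_η` in the variable `xᵢ`
has the derivative `2(ξᵢ - ηᵢ) h_ξ h_η`. Integrating `⟨v_ξ, v_η⟩` by parts `N` times against it
gains `⟨η⟩^{-1/2}` per step if `⟨η⟩ ≥ 2⟨ξ⟩`, while a derivative of the symbols costs `⟨η⟩^{δ/2}`.
Hence `|⟨v_ξ, v_η⟩| ≤ C ⟨η⟩^{-p} ≤ C (⟨ξ⟩⟨η⟩)^{-p/2}` with `p = N(1-δ)/2 > n`, and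
`∑_ξ ⟨ξ⟩^{-p} < ∞`.

In the square of the norm of the sum over all shells, the first bound takes care of the pairs of
neighbouring shells and the second one of all other pairs (`exists_norm_sq_sum_le`). Completeness of
the Hermite functions is not needed.
-/

noncomputable section

namespace HermitePM

/-! ### Hermite functions of one variable -/

/-- The Hermite function `H_k(t) e^{-t²/2}` without its normalising factor. In this form the ladder
relations have integer coefficients. -/
def hermiteE1 (k : ℕ) (t : ℝ) : ℝ := hermiteH k t * Real.exp (-t ^ 2 / 2)

/-- The squared `L²` norm `2^k k! √π` of `hermiteE1 k`. -/
def hermiteNormSq1 (k : ℕ) : ℝ := 2 ^ k * (k.factorial : ℝ) * Real.sqrt Real.pi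

lemma hermiteNormSq1_pos (k : ℕ) : 0 < hermiteNormSq1 k := by
  unfold hermiteNormSq1; positivity

lemma hermiteNormSq1_succ (k : ℕ) : hermiteNormSq1 (k + 1) = 2 * (k + 1) * hermiteNormSq1 k := by
  simp only [hermiteNormSq1, Nat.factorial_succ, pow_succ]; push_cast; ring

lemma hermiteFun1_eq (k : ℕ) (t : ℝ) :
    hermiteFun1 k t = (Real.sqrt (hermiteNormSq1 k))⁻¹ * hermiteE1 k t := by
  simp only [hermiteFun1, hermiteE1, hermiteNormSq1]; ring

lemma contDiff_exp_neg_sq : ContDiff ℝ ⊤ (fun s : ℝ => Real.exp (-s ^ 2)) := by fun_prop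

lemma hasDerivAt_iteratedDeriv_exp_neg_sq (k : ℕ) (t : ℝ) :
    HasDerivAt (iteratedDeriv k (fun s : ℝ => Real.exp (-s ^ 2)))
      (iteratedDeriv (k + 1) (fun s : ℝ => Real.exp (-s ^ 2)) t) t := by
  rw [iteratedDeriv_succ]
  exact ((contDiff_exp_neg_sq.of_le le_top).differentiable_iteratedDeriv k
    (by exact_mod_cast WithTop.coe_lt_top (α := ℕ∞) (k : ℕ∞)) t).hasDerivAt

lemma iteratedDeriv_exp_neg_sq_succ (k : ℕ) (t : ℝ) :
    iteratedDeriv (k + 1) (fun s : ℝ => Real.exp (-s ^ 2)) t =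
      -2 * t * iteratedDeriv k (fun s : ℝ => Real.exp (-s ^ 2)) t -
        2 * k * iteratedDeriv (k - 1) (fun s : ℝ => Real.exp (-s ^ 2)) t := by
  induction k generalizing t with
  | zero =>
    have h : HasDerivAt (fun s : ℝ => Real.exp (-s ^ 2)) (Real.exp (-t ^ 2) * (-(2 * t))) t := by
      simpa using ((hasDerivAt_pow 2 t).neg).exp
    rw [iteratedDeriv_one, h.deriv]
    simp; ring
  | succ k ih =>
    have h1 := hasDerivAt_iteratedDeriv_exp_neg_sq (k + 1) t
    have h2 := (((hasDerivAt_id t).const_mul (-2 : ℝ)).mul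
      (hasDerivAt_iteratedDeriv_exp_neg_sq k t)).sub
        ((hasDerivAt_iteratedDeriv_exp_neg_sq (k - 1) t).const_mul (2 * (k : ℝ)))
    have h3 := h1.unique (h2.congr_of_eventuallyEq (Eventually.of_forall fun s => by
      simpa using ih s))
    rw [h3]
    rcases k with _ | k
    · simp; ring
    · simp; ring

lemma hasDerivAt_hermiteE1 (k : ℕ) (t : ℝ) :
    HasDerivAt (hermiteE1 k) (t * hermiteE1 k t - hermiteE1 (k + 1) t) t := by
  have h1 : HasDerivAt (fun s : ℝ => Real.exp (s ^ 2)) (Real.exp (t ^ 2) * (2 * t)) t := by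
    simpa using ((hasDerivAt_pow 2 t)).exp
  have h2 : HasDerivAt (fun s : ℝ => Real.exp (-s ^ 2 / 2)) (Real.exp (-t ^ 2 / 2) * (-t)) t := by
    convert (((hasDerivAt_pow 2 t).fun_neg).div_const 2).exp using 1
    push_cast; ring
  have h := ((h1.const_mul ((-1 : ℝ) ^ k)).mul (hasDerivAt_iteratedDeriv_exp_neg_sq k t)).mul h2
  refine (h.congr_deriv ?_)
  simp only [hermiteE1, hermiteH, pow_succ, Pi.mul_apply]
  ring

lemma hermiteE1_ladder (k : ℕ) (t : ℝ) :
    t * hermiteE1 k t = 1 / 2 * hermiteE1 (k + 1) t + k * hermiteE1 (k - 1) t := by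
  simp only [hermiteE1, hermiteH, iteratedDeriv_exp_neg_sq_succ k t]
  rcases k with _ | k
  · simp; ring
  · simp [pow_succ]; ring

lemma continuous_hermiteE1 (k : ℕ) : Continuous (hermiteE1 k) :=
  continuous_iff_continuousAt.2 fun t => (hasDerivAt_hermiteE1 k t).continuousAt

lemma hermiteE1_zero (t : ℝ) : hermiteE1 0 t = Real.exp (-t ^ 2 / 2) := by
  simp only [hermiteE1, hermiteH, iteratedDeriv_zero, pow_zero, one_mul, ← Real.exp_add]
  congr 1; ring

lemma abs_mul_exp_le {a b : ℝ} (hab : a < b) (t : ℝ) :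
    |t| * Real.exp (-b * t ^ 2) ≤ (1 + 1 / (b - a)) * Real.exp (-a * t ^ 2) := by
  have h0 : 0 < b - a := sub_pos.2 hab
  have h1 : Real.exp (-b * t ^ 2) = Real.exp (-((b - a) * t ^ 2)) * Real.exp (-a * t ^ 2) := by
    rw [← Real.exp_add]; congr 1; ring
  rw [h1, ← mul_assoc]
  refine mul_le_mul_of_nonneg_right ?_ (Real.exp_pos _).le
  rw [Real.exp_neg, ← div_eq_mul_inv, div_le_iff₀ (Real.exp_pos _)]
  have h2 := Real.add_one_le_exp ((b - a) * t ^ 2)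
  have h3 : |t| ≤ 1 + t ^ 2 := by rw [← sq_abs]; nlinarith [sq_nonneg (|t| - 1), abs_nonneg t]
  calc |t| ≤ 1 + t ^ 2 := h3
    _ ≤ (1 + 1 / (b - a)) * ((b - a) * t ^ 2 + 1) := by
        have : (1 + 1 / (b - a)) * ((b - a) * t ^ 2 + 1) =
          1 + t ^ 2 + ((b - a) * t ^ 2 + 1 / (b - a)) := by field_simp; ring
        rw [this]; have : 0 ≤ (b - a) * t ^ 2 + 1 / (b - a) := by positivity
        linarith
    _ ≤ _ := by gcongr

/-- Each step of the recurrence for `hermiteE1` costs a factor `t`, which is absorbed by lowering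
the Gaussian rate `b` slightly. -/
lemma exists_hermiteE1_bound (k : ℕ) :
    ∀ b : ℝ, b < 1 / 2 → ∃ C : ℝ, ∀ t, |hermiteE1 k t| ≤ C * Real.exp (-b * t ^ 2) := by
  induction k using Nat.strong_induction_on with
  | _ k ih =>
    intro b hb
    rcases k with _ | k
    · refine ⟨1, fun t => ?_⟩
      rw [hermiteE1_zero, one_mul, abs_of_pos (Real.exp_pos _)]
      gcongr; nlinarith [sq_nonneg t]
    · obtain ⟨C1, h1⟩ := ih k (by omega) ((b + 1 / 2) / 2) (by linarith)
      obtain ⟨C2, h2⟩ : ∃ C : ℝ, ∀ t, |(k : ℝ) * hermiteE1 (k - 1) t| ≤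
          C * Real.exp (-b * t ^ 2) := by
        rcases k with _ | k
        · exact ⟨0, fun t => by simp⟩
        · obtain ⟨C, h⟩ := ih k (by omega) b hb
          refine ⟨(k + 1 : ℕ) * C, fun t => ?_⟩
          rw [abs_mul, mul_assoc, Nat.abs_cast]
          exact mul_le_mul_of_nonneg_left (h t) (by positivity)
      have hC1 : 0 ≤ C1 := by
        have := (abs_nonneg _).trans (h1 0); simpa using this
      refine ⟨2 * (C1 * (1 + 1 / ((b + 1 / 2) / 2 - b))) + 2 * C2, fun t => ?_⟩
      have e : hermiteE1 (k + 1) t = 2 * (t * hermiteE1 k t) - 2 * (k * hermiteE1 (k - 1) t) := by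
        rw [hermiteE1_ladder]; ring
      have h3 := abs_mul_exp_le (a := b) (b := (b + 1 / 2) / 2) (by linarith) t
      rw [e]
      calc _ ≤ |2 * (t * hermiteE1 k t)| + |2 * (k * hermiteE1 (k - 1) t)| := abs_sub _ _
        _ = 2 * (|t| * |hermiteE1 k t|) + 2 * |k * hermiteE1 (k - 1) t| := by
            simp [abs_mul]
        _ ≤ 2 * (|t| * (C1 * Real.exp (-((b + 1 / 2) / 2) * t ^ 2))) +
            2 * (C2 * Real.exp (-b * t ^ 2)) := by
            gcongr
            · exact h1 t
            · exact h2 t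
        _ = 2 * (C1 * (|t| * Real.exp (-((b + 1 / 2) / 2) * t ^ 2))) +
            2 * (C2 * Real.exp (-b * t ^ 2)) := by ring
        _ ≤ 2 * (C1 * ((1 + 1 / ((b + 1 / 2) / 2 - b)) * Real.exp (-b * t ^ 2))) +
            2 * (C2 * Real.exp (-b * t ^ 2)) := by
            gcongr
        _ = _ := by ring

lemma integrable_hermiteE1_mul (k l : ℕ) :
    Integrable (fun t => hermiteE1 k t * hermiteE1 l t) := by
  obtain ⟨C, hC⟩ := exists_hermiteE1_bound k (1 / 4) (by norm_num)
  obtain ⟨D, hD⟩ := exists_hermiteE1_bound l (1 / 4) (by norm_num)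
  refine ((integrable_exp_neg_mul_sq (b := 1 / 2) (by norm_num)).const_mul (C * D)).mono'
    ((continuous_hermiteE1 k).mul (continuous_hermiteE1 l)).aestronglyMeasurable
    (Eventually.of_forall fun t => ?_)
  rw [norm_mul]
  calc _ ≤ (C * Real.exp (-(1 / 4) * t ^ 2)) * (D * Real.exp (-(1 / 4) * t ^ 2)) :=
        mul_le_mul (hC t) (hD t) (abs_nonneg _) ((abs_nonneg _).trans (hC t))
    _ = C * D * (Real.exp (-(1 / 4) * t ^ 2) * Real.exp (-(1 / 4) * t ^ 2)) := by ring
    _ = _ := by rw [← Real.exp_add]; congr 2; ring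

lemma tendsto_hermiteE1_atBot (k : ℕ) : Tendsto (hermiteE1 k) atBot (𝓝 0) := by
  obtain ⟨C, hC⟩ := exists_hermiteE1_bound k (1 / 4) (by norm_num)
  refine squeeze_zero_norm hC ?_
  have h1 : Tendsto (fun t : ℝ => t ^ 2) atBot atTop := by
    have := (tendsto_pow_atTop (α := ℝ) (n := 2) (by norm_num)).comp tendsto_neg_atBot_atTop
    simpa [Function.comp_def] using this
  have h2 : Tendsto (fun t : ℝ => -(1 / 4 : ℝ) * t ^ 2) atBot atBot :=
    h1.const_mul_atTop_of_neg (by norm_num)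
  simpa using (Real.tendsto_exp_atBot.comp h2).const_mul C

/-- The raising operator `t - d/dt` is the adjoint of `t + d/dt`. -/
lemma integral_hermiteE1_succ_mul (k l : ℕ) :
    ∫ t, hermiteE1 (k + 1) t * hermiteE1 l t =
      2 * l * ∫ t, hermiteE1 k t * hermiteE1 (l - 1) t := by
  have hx : ∀ j m : ℕ, Integrable (fun t => t * hermiteE1 j t * hermiteE1 m t) := fun j m => by
    simp_rw [hermiteE1_ladder, add_mul, mul_assoc]
    exact ((integrable_hermiteE1_mul _ _).const_mul _).add
      ((integrable_hermiteE1_mul _ _).const_mul _)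
  have e1 : (fun t => hermiteE1 k t * (t * hermiteE1 l t - hermiteE1 (l + 1) t)) = fun t =>
      t * hermiteE1 k t * hermiteE1 l t - hermiteE1 k t * hermiteE1 (l + 1) t := by
    ext t; ring
  have e2 : (fun t => (t * hermiteE1 k t - hermiteE1 (k + 1) t) * hermiteE1 l t) = fun t =>
      t * hermiteE1 k t * hermiteE1 l t - hermiteE1 (k + 1) t * hermiteE1 l t := by
    ext t; ring
  have i1 : Integrable (fun t => hermiteE1 k t * (t * hermiteE1 l t - hermiteE1 (l + 1) t)) := by
    rw [e1]; exact (hx k l).sub (integrable_hermiteE1_mul _ _)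
  have i2 : Integrable (fun t => (t * hermiteE1 k t - hermiteE1 (k + 1) t) * hermiteE1 l t) := by
    rw [e2]; exact (hx k l).sub (integrable_hermiteE1_mul _ _)
  have h := integral_mul_deriv_eq_deriv_mul_of_integrable
    (fun x _ => hasDerivAt_hermiteE1 k x) (fun x _ => hasDerivAt_hermiteE1 l x) i1 i2
    (integrable_hermiteE1_mul k l)
  rw [e1, e2, integral_sub (hx k l) (integrable_hermiteE1_mul _ _),
    integral_sub (hx k l) (integrable_hermiteE1_mul _ _)] at h
  have e3 : ∫ t, t * hermiteE1 k t * hermiteE1 l t =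
      1 / 2 * (∫ t, hermiteE1 k t * hermiteE1 (l + 1) t) +
        l * ∫ t, hermiteE1 k t * hermiteE1 (l - 1) t := by
    rw [← integral_const_mul, ← integral_const_mul, ← integral_add
      ((integrable_hermiteE1_mul _ _).const_mul _) ((integrable_hermiteE1_mul _ _).const_mul _)]
    refine integral_congr_ae (Eventually.of_forall fun t => ?_)
    have := hermiteE1_ladder l t
    simp only
    rw [mul_right_comm, mul_comm (t * _), this]; ring
  rw [e3] at h
  linarith

lemma integral_hermiteE1_mul (k l : ℕ) :
    ∫ t, hermiteE1 k t * hermiteE1 l t = if k = l then hermiteNormSq1 k else 0 := by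
  induction k generalizing l with
  | zero =>
    rcases l with _ | l
    · have : (fun t => hermiteE1 0 t * hermiteE1 0 t) = fun t => Real.exp (-1 * t ^ 2) := by
        ext t; rw [hermiteE1_zero, ← Real.exp_add]; congr 1; ring
      rw [this, integral_gaussian]; simp [hermiteNormSq1]
    · have := integral_hermiteE1_succ_mul l 0
      simp_rw [mul_comm (hermiteE1 0 _)]
      rw [this]; simp
  | succ k ih =>
    rw [integral_hermiteE1_succ_mul]
    rcases l with _ | l
    · simp
    · rw [Nat.add_sub_cancel, ih]
      by_cases h : k = l
      · subst h; simp [hermiteNormSq1_succ]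
      · simp [h]

/-- The derivative of `∑_{k ≤ m} h_k²` telescopes to `-√(2(m+1)) h_m h_{m+1}`, whose `L¹` norm is
at most `√(2(m+1))`. -/
lemma sum_sq_hermiteE1_le (m : ℕ) (x : ℝ) :
    ∑ k ∈ Finset.range (m + 1), hermiteE1 k x ^ 2 / hermiteNormSq1 k ≤ Real.sqrt (2 * (m + 1)) := by
  have hpos := hermiteNormSq1_pos
  have hd : ∀ t, HasDerivAt (fun t => ∑ k ∈ Finset.range (m + 1),
      hermiteE1 k t ^ 2 / hermiteNormSq1 k) (-(hermiteE1 m t * hermiteE1 (m + 1) t) /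
        hermiteNormSq1 m) t := by
    intro t
    have h1 : ∀ k ∈ Finset.range (m + 1), HasDerivAt (fun t => hermiteE1 k t ^ 2 / hermiteNormSq1 k)
        (2 * hermiteE1 k t * (t * hermiteE1 k t - hermiteE1 (k + 1) t) / hermiteNormSq1 k) t := by
      intro k _
      simpa using ((hasDerivAt_hermiteE1 k t).pow 2).div_const (hermiteNormSq1 k)
    refine (HasDerivAt.fun_sum h1).congr_deriv ?_
    clear h1
    induction m with
    | zero =>
      have := hermiteE1_ladder 0 t
      simp at this ⊢
      rw [this]; field_simp; ring
    | succ m ih =>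
      rw [Finset.sum_range_succ, ih, hermiteE1_ladder (m + 1) t, hermiteNormSq1_succ]
      have := (hpos m).ne'
      simp
      field_simp; ring
  have hint : Integrable (fun t => -(hermiteE1 m t * hermiteE1 (m + 1) t) / hermiteNormSq1 m) :=
    ((integrable_hermiteE1_mul m (m + 1)).neg).div_const _
  have hlim : Tendsto (fun t => ∑ k ∈ Finset.range (m + 1),
      hermiteE1 k t ^ 2 / hermiteNormSq1 k) atBot (𝓝 0) := by
    have := tendsto_finsetSum (Finset.range (m + 1)) fun k _ =>
      ((tendsto_hermiteE1_atBot k).pow 2).div_const (hermiteNormSq1 k)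
    simpa using this
  have key := integral_Iic_of_hasDerivAt_of_tendsto' (a := x) (fun t _ => hd t)
    hint.integrableOn hlim
  rw [sub_zero] at key
  rw [← key]
  set s := Real.sqrt (2 * (m + 1)) with hs
  have hs0 : 0 < s := Real.sqrt_pos.2 (by positivity)
  have hs2 : s ^ 2 = 2 * (m + 1) := Real.sq_sqrt (by positivity)
  have hsum : Integrable (fun t => s / 2 * (hermiteE1 m t * hermiteE1 m t / hermiteNormSq1 m +
      hermiteE1 (m + 1) t * hermiteE1 (m + 1) t / hermiteNormSq1 (m + 1))) :=
    (((integrable_hermiteE1_mul m m).div_const _).add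
      ((integrable_hermiteE1_mul (m + 1) (m + 1)).div_const _)).const_mul _
  calc _ ≤ ∫ t in Set.Iic x, s / 2 * (hermiteE1 m t * hermiteE1 m t / hermiteNormSq1 m +
      hermiteE1 (m + 1) t * hermiteE1 (m + 1) t / hermiteNormSq1 (m + 1)) := by
        refine setIntegral_mono hint.integrableOn hsum.integrableOn fun t => ?_
        have h := hpos m
        have : 0 ≤ s / 2 * (hermiteE1 m t + hermiteE1 (m + 1) t / s) ^ 2 / hermiteNormSq1 m := by
          positivity
        simp only
        rw [hermiteNormSq1_succ, ← hs2, ← sub_nonneg]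
        refine this.trans_eq ?_
        field_simp; ring
    _ ≤ ∫ t, s / 2 * (hermiteE1 m t * hermiteE1 m t / hermiteNormSq1 m +
      hermiteE1 (m + 1) t * hermiteE1 (m + 1) t / hermiteNormSq1 (m + 1)) := by
        refine setIntegral_le_integral hsum (Eventually.of_forall fun t => ?_)
        have h1 := hpos m
        have h2 := hpos (m + 1)
        have h3 := mul_self_nonneg (hermiteE1 m t)
        have h4 := mul_self_nonneg (hermiteE1 (m + 1) t)
        simp only [Pi.zero_apply]
        positivity
    _ = s := by
        rw [integral_const_mul, integral_add ((integrable_hermiteE1_mul m m).div_const _)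
          ((integrable_hermiteE1_mul (m + 1) (m + 1)).div_const _), integral_div, integral_div,
          integral_hermiteE1_mul, integral_hermiteE1_mul]
        simp [(hpos m).ne', (hpos (m + 1)).ne']
        ring

/-! ### Hermite functions of several variables -/

variable {n : ℕ}

/-- The unnormalised Hermite function `∏ⱼ H_{ξⱼ}(xⱼ) e^{-xⱼ²/2}`. -/
def hermiteE (ξ : MIdx n) (x : Rn n) : ℝ := ∏ j, hermiteE1 (ξ j) (x j)

/-- The squared `L²` norm of `hermiteE ξ`. -/
def hermiteNormSq (ξ : MIdx n) : ℝ := ∏ j, hermiteNormSq1 (ξ j)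

lemma hermiteNormSq_pos (ξ : MIdx n) : 0 < hermiteNormSq ξ :=
  Finset.prod_pos fun _ _ => hermiteNormSq1_pos _

lemma hermiteFun_eq (ξ : MIdx n) (x : Rn n) :
    hermiteFun ξ x = (Real.sqrt (hermiteNormSq ξ))⁻¹ * hermiteE ξ x := by
  have h : Real.sqrt (hermiteNormSq ξ) = ∏ j, Real.sqrt (hermiteNormSq1 (ξ j)) :=
    Real.sqrt_prod _ fun _ _ => (hermiteNormSq1_pos _).le
  simp only [hermiteFun, hermiteE, hermiteFun1_eq, Finset.prod_mul_distrib, Finset.prod_inv_distrib,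
    h]

lemma hermiteE_eq_mul_prod_erase (i : Fin n) {ξ η : MIdx n} (h : ∀ j ≠ i, η j = ξ j) (x : Rn n) :
    hermiteE η x = hermiteE1 (η i) (x i) * ∏ j ∈ Finset.univ.erase i, hermiteE1 (ξ j) (x j) := by
  rw [hermiteE, ← Finset.mul_prod_erase _ _ (Finset.mem_univ i)]
  congr 1
  exact Finset.prod_congr rfl fun j hj => by rw [h j (Finset.ne_of_mem_erase hj)]

lemma hermiteNormSq_add_single (ξ : MIdx n) (i : Fin n) :
    hermiteNormSq (ξ + Pi.single i 1) = 2 * (ξ i + 1) * hermiteNormSq ξ := by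
  rw [hermiteNormSq, hermiteNormSq, ← Finset.mul_prod_erase _ _ (Finset.mem_univ i),
    ← Finset.mul_prod_erase _ (fun j => hermiteNormSq1 (ξ j)) (Finset.mem_univ i), ← mul_assoc]
  congr 1
  · simp [hermiteNormSq1_succ]
  · exact Finset.prod_congr rfl fun j hj => by simp [Finset.ne_of_mem_erase hj]

lemma len_add_single (ξ : MIdx n) (i : Fin n) :
    MIdx.len (ξ + Pi.single i 1) = MIdx.len ξ + 1 := by
  simp [MIdx.len, Finset.sum_add_distrib]

lemma le_len (ξ : MIdx n) (i : Fin n) : ξ i ≤ MIdx.len ξ :=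
  Finset.single_le_sum (f := ξ) (fun _ _ => Nat.zero_le _) (Finset.mem_univ i)

lemma continuous_hermiteE (ξ : MIdx n) : Continuous (hermiteE ξ) := by
  unfold hermiteE
  exact continuous_finsetProd _ fun j _ => (continuous_hermiteE1 _).comp (by fun_prop)

lemma continuous_hermiteFun (ξ : MIdx n) : Continuous (hermiteFun ξ) := by
  have : hermiteFun ξ = fun x => (Real.sqrt (hermiteNormSq ξ))⁻¹ * hermiteE ξ x :=
    funext (hermiteFun_eq ξ)
  rw [this]
  exact continuous_const.mul (continuous_hermiteE ξ)

lemma hermiteE_ladder (ξ : MIdx n) (i : Fin n) (x : Rn n) :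
    x i * hermiteE ξ x =
      1 / 2 * hermiteE (ξ + Pi.single i 1) x + ξ i * hermiteE (ξ - Pi.single i 1) x := by
  rw [hermiteE_eq_mul_prod_erase i (ξ := ξ) (η := ξ) (fun _ _ => rfl),
    hermiteE_eq_mul_prod_erase i (ξ := ξ) (η := ξ + Pi.single i 1) (fun j hj => by simp [hj]),
    hermiteE_eq_mul_prod_erase i (ξ := ξ) (η := ξ - Pi.single i 1) (fun j hj => by simp [hj]),
    ← mul_assoc, hermiteE1_ladder]
  simp
  ring

lemma hasLineDerivAt_hermiteE (ξ : MIdx n) (i : Fin n) (x : Rn n) :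
    HasLineDerivAt ℝ (hermiteE ξ) (x i * hermiteE ξ x - hermiteE (ξ + Pi.single i 1) x) x
      (EuclideanSpace.single i 1) := by
  unfold HasLineDerivAt
  have e : (fun t : ℝ => hermiteE ξ (x + t • EuclideanSpace.single i (1 : ℝ))) = fun t : ℝ =>
      hermiteE1 (ξ i) (x i + t) * ∏ j ∈ Finset.univ.erase i, hermiteE1 (ξ j) (x j) := by
    ext t
    rw [hermiteE_eq_mul_prod_erase i (ξ := ξ) (η := ξ) (fun _ _ => rfl)]
    congr 1
    · simp
    · exact Finset.prod_congr rfl fun j hj => by simp [Finset.ne_of_mem_erase hj]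
  rw [e]
  have h1 : HasDerivAt (fun t : ℝ => hermiteE1 (ξ i) (x i + t)) _ 0 :=
    HasDerivAt.comp_const_add (x i) 0 (hasDerivAt_hermiteE1 (ξ i) (x i + 0))
  refine (h1.mul_const _).congr_deriv ?_
  rw [hermiteE_eq_mul_prod_erase i (ξ := ξ) (η := ξ) (fun _ _ => rfl),
    hermiteE_eq_mul_prod_erase i (ξ := ξ) (η := ξ + Pi.single i 1) (fun j hj => by simp [hj])]
  simp
  ring

lemma integrable_hermiteE_mul (ξ η : MIdx n) :
    Integrable (fun x => hermiteE ξ x * hermiteE η x) := by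
  have h : Integrable (fun y : Fin n → ℝ => ∏ j, (hermiteE1 (ξ j) (y j) * hermiteE1 (η j) (y j))) :=
    Integrable.fintype_prod (f := fun j t => hermiteE1 (ξ j) t * hermiteE1 (η j) t)
      fun j => integrable_hermiteE1_mul _ _
  have h2 := (PiLp.volume_preserving_ofLp (Fin n)).integrable_comp_of_integrable h
  refine h2.congr (Eventually.of_forall fun x => ?_)
  simp [hermiteE, Finset.prod_mul_distrib]

lemma integral_hermiteE_mul (ξ η : MIdx n) :
    ∫ x, hermiteE ξ x * hermiteE η x = if ξ = η then hermiteNormSq ξ else 0 := by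
  have h2 := (PiLp.volume_preserving_ofLp (Fin n)).integral_comp
    (MeasurableEquiv.toLp 2 (Fin n → ℝ)).symm.measurableEmbedding
    (fun y : Fin n → ℝ => ∏ j, (hermiteE1 (ξ j) (y j) * hermiteE1 (η j) (y j)))
  have h3 := integral_fintype_prod_volume_eq_prod
    (fun (j : Fin n) (t : ℝ) => hermiteE1 (ξ j) t * hermiteE1 (η j) t)
  simp only [hermiteE, ← Finset.prod_mul_distrib]
  refine h2.trans (h3.trans ?_)
  simp_rw [integral_hermiteE1_mul]
  split_ifs with h
  · subst h; simp [hermiteNormSq]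
  · obtain ⟨j, hj⟩ := Function.ne_iff.1 h
    exact Finset.prod_eq_zero (Finset.mem_univ j) (by simp [hj])

/-- The box `{0, …, L}ⁿ` of multi-indices. -/
def box (n L : ℕ) : Finset (MIdx n) := Fintype.piFinset fun _ => Finset.range (L + 1)

lemma mem_box {L : ℕ} {ξ : MIdx n} : ξ ∈ box n L ↔ ∀ i, ξ i ≤ L := by
  simp [box]

lemma sum_sq_hermiteE_le (L : ℕ) (x : Rn n) :
    ∑ ξ ∈ box n L, hermiteE ξ x ^ 2 / hermiteNormSq ξ ≤ Real.sqrt (2 * (L + 1)) ^ n := by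
  have h : ∀ ξ : MIdx n, hermiteE ξ x ^ 2 / hermiteNormSq ξ =
      ∏ j, (hermiteE1 (ξ j) (x j) ^ 2 / hermiteNormSq1 (ξ j)) := fun ξ => by
    simp [hermiteE, hermiteNormSq, Finset.prod_pow, Finset.prod_div_distrib]
  simp_rw [h]
  rw [box, Finset.sum_prod_piFinset (Finset.range (L + 1))
    (fun j k => hermiteE1 k (x j) ^ 2 / hermiteNormSq1 k)]
  refine (Finset.prod_le_prod (fun j _ => Finset.sum_nonneg fun k _ => ?_)
    fun j _ => sum_sq_hermiteE1_le L (x j)).trans_eq (by simp)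
  have := hermiteNormSq1_pos k
  positivity

/-- Parseval's identity for finite combinations of Hermite functions. -/
lemma lintegral_enorm_sq_sum_hermiteE {ι : Type*} (s : Finset ι) (m : ι → MIdx n)
    (hm : Function.Injective m) (c : ι → ℂ) :
    ∫⁻ y, ‖∑ k ∈ s, c k * (hermiteE (m k) y : ℂ)‖ₑ ^ 2 =
      ENNReal.ofReal (∑ k ∈ s, ‖c k‖ ^ 2 * hermiteNormSq (m k)) := by
  classical
  have e : ∀ y, ((‖∑ k ∈ s, c k * (hermiteE (m k) y : ℂ)‖ ^ 2 : ℝ) : ℂ) =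
      ∑ k ∈ s, ∑ l ∈ s, c k * (starRingEnd ℂ) (c l) *
        ((hermiteE (m k) y * hermiteE (m l) y : ℝ) : ℂ) := fun y => by
    rw [Complex.ofReal_pow, ← Complex.mul_conj', map_sum, Finset.sum_mul_sum]
    refine Finset.sum_congr rfl fun k _ => Finset.sum_congr rfl fun l _ => ?_
    simp; ring
  have hi : ∀ k l, Integrable fun y => c k * (starRingEnd ℂ) (c l) *
        ((hermiteE (m k) y * hermiteE (m l) y : ℝ) : ℂ) := fun k l =>
    ((integrable_hermiteE_mul (m k) (m l)).ofReal).const_mul _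
  have hiC : Integrable fun y => ((‖∑ k ∈ s, c k * (hermiteE (m k) y : ℂ)‖ ^ 2 : ℝ) : ℂ) := by
    simp_rw [e]
    exact integrable_finsetSum _ fun k _ => integrable_finsetSum _ fun l _ => hi k l
  have hiR : Integrable fun y => ‖∑ k ∈ s, c k * (hermiteE (m k) y : ℂ)‖ ^ 2 := by
    simpa only [RCLike.re_to_complex, Complex.ofReal_re] using hiC.re
  have hval : ∫ y, ‖∑ k ∈ s, c k * (hermiteE (m k) y : ℂ)‖ ^ 2 =
      ∑ k ∈ s, ‖c k‖ ^ 2 * hermiteNormSq (m k) := by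
    apply Complex.ofReal_injective
    rw [← integral_complex_ofReal]
    simp_rw [e]
    rw [integral_finsetSum _ fun k _ => integrable_finsetSum _ fun l _ => hi k l]
    rw [Complex.ofReal_sum]
    refine Finset.sum_congr rfl fun k hk => ?_
    rw [integral_finsetSum _ fun l _ => hi k l]
    have : ∀ l, ∫ y, c k * (starRingEnd ℂ) (c l) *
        ((hermiteE (m k) y * hermiteE (m l) y : ℝ) : ℂ) =
        if k = l then c k * (starRingEnd ℂ) (c l) * (hermiteNormSq (m k) : ℂ) else 0 := fun l => by
      rw [integral_const_mul, integral_complex_ofReal, integral_hermiteE_mul]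
      by_cases h : k = l
      · simp [h]
      · simp [h, hm.ne h]
    simp_rw [this]
    simp [hk, Complex.mul_conj']
  rw [← hval, ofReal_integral_eq_lintegral_ofReal hiR (Eventually.of_forall fun y => by positivity)]
  refine lintegral_congr fun y => ?_
  rw [ENNReal.ofReal_pow (norm_nonneg _), ofReal_norm]

/-! ### Weighted bounds for kernels -/

/-- The result of applying `p` times the difference `A_y - A_x` of the raising operators in the
`i`-th variables to the function `(x, y) ↦ hermiteE ξ x * hermiteE η y`. -/
def pairE (i : Fin n) : ℕ → MIdx n → MIdx n → Rn n → Rn n → ℝ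
  | 0, ξ, η, x, y => hermiteE ξ x * hermiteE η y
  | p + 1, ξ, η, x, y =>
    pairE i p ξ (η + Pi.single i 1) x y - pairE i p (ξ + Pi.single i 1) η x y

lemma sub_add_single {ξ : MIdx n} {i : Fin n} (h : ξ i ≠ 0) :
    ξ - Pi.single i 1 + Pi.single i 1 = ξ := by
  refine tsub_add_cancel_of_le fun j => ?_
  by_cases hj : j = i
  · subst hj; simpa using Nat.one_le_iff_ne_zero.2 h
  · simp [hj]

lemma continuous_pairE (i : Fin n) (p : ℕ) (ξ η : MIdx n) (x : Rn n) :
    Continuous (pairE i p ξ η x) := by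
  induction p generalizing ξ η with
  | zero => exact continuous_const.mul (continuous_hermiteE η)
  | succ p ih => exact (ih ξ _).sub (ih _ η)

/-- Multiplication by `xᵢ - yᵢ` and `A_y - A_x` have the scalar commutator `-2`. -/
lemma sub_mul_pairE (i : Fin n) (p : ℕ) (ξ η : MIdx n) (x y : Rn n) :
    (x i - y i) * pairE i p ξ η x y =
      1 / 2 * (pairE i p (ξ + Pi.single i 1) η x y - pairE i p ξ (η + Pi.single i 1) x y) +
        ξ i * pairE i p (ξ - Pi.single i 1) η x y - η i * pairE i p ξ (η - Pi.single i 1) x y -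
        2 * p * pairE i (p - 1) ξ η x y := by
  induction p generalizing ξ η with
  | zero =>
    have h1 := hermiteE_ladder ξ i x
    have h2 := hermiteE_ladder η i y
    simp only [pairE, Nat.cast_zero, mul_zero, zero_mul, sub_zero]
    linear_combination hermiteE η y * h1 - hermiteE ξ x * h2
  | succ p ih =>
    have key : ∀ (F : MIdx n → ℝ) (ξ : MIdx n),
        (ξ i : ℝ) * F (ξ - Pi.single i 1 + Pi.single i 1) = ξ i * F ξ := fun F ξ => by
      by_cases h : ξ i = 0
      · simp [h]
      · rw [sub_add_single h]
    have k1 := key (fun ζ => pairE i p ζ η x y) ξ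
    have k2 := key (fun ζ => pairE i p ξ ζ x y) η
    have hp : 2 * (p : ℝ) * (pairE i (p - 1) ξ (η + Pi.single i 1) x y -
        pairE i (p - 1) (ξ + Pi.single i 1) η x y) = 2 * p * pairE i p ξ η x y := by
      rcases p with _ | p
      · simp
      · simp [pairE]
    have h1 := ih ξ (η + Pi.single i 1)
    have h2 := ih (ξ + Pi.single i 1) η
    simp only [add_tsub_cancel_right, Pi.add_apply, Pi.single_eq_same, Nat.cast_add,
      Nat.cast_one] at h1 h2
    simp only [pairE, add_tsub_cancel_right, Nat.cast_add, Nat.cast_one] at k1 k2 ⊢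
    linear_combination h1 - h2 + k1 + k2 - hp

lemma lintegral_enorm_sq_sub_le {α : Type*} [MeasurableSpace α] {μ : Measure α} {f g : α → ℂ}
    (hf : AEMeasurable f μ) :
    ∫⁻ y, ‖f y - g y‖ₑ ^ 2 ∂μ ≤ 2 * ∫⁻ y, ‖f y‖ₑ ^ 2 ∂μ + 2 * ∫⁻ y, ‖g y‖ₑ ^ 2 ∂μ := by
  rw [← lintegral_const_mul' _ _ (by simp), ← lintegral_const_mul' _ _ (by simp),
    ← lintegral_add_left' ((hf.enorm.pow_const 2).const_mul 2)]
  refine lintegral_mono fun y => ?_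
  have h : ‖f y - g y‖ ^ 2 ≤ 2 * ‖f y‖ ^ 2 + 2 * ‖g y‖ ^ 2 := by
    nlinarith [norm_sub_le (f y) (g y), norm_nonneg (f y - g y), sq_nonneg (‖f y‖ - ‖g y‖)]
  have := ENNReal.ofReal_le_ofReal h
  rw [ENNReal.ofReal_add (by positivity) (by positivity), ENNReal.ofReal_mul (by norm_num),
    ENNReal.ofReal_mul (by norm_num), ENNReal.ofReal_pow (norm_nonneg _),
    ENNReal.ofReal_pow (norm_nonneg _), ENNReal.ofReal_pow (norm_nonneg _)] at this
  simpa using this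

lemma lintegral_enorm_sq_const_mul {α : Type*} [MeasurableSpace α] {μ : Measure α} (c : ℂ)
    (f : α → ℂ) :
    ∫⁻ y, ‖c * f y‖ₑ ^ 2 ∂μ = ENNReal.ofReal (‖c‖ ^ 2) * ∫⁻ y, ‖f y‖ₑ ^ 2 ∂μ := by
  rw [← lintegral_const_mul' _ _ (by simp)]
  refine lintegral_congr fun y => ?_
  rw [enorm_mul, mul_pow, ENNReal.ofReal_pow (norm_nonneg _), ofReal_norm]

/-- The kernel `∑_ξ τ(ξ) h_ξ(x) h_ξ(y)` after `p` applications of `A_y - A_x`, with the two Hermite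
functions shifted by `a` and `b` in the `i`-th index. -/
def kernelSum (L : ℕ) (i : Fin n) (p a b : ℕ) (τ : MIdx n → ℂ) (x y : Rn n) : ℂ :=
  ∑ ξ ∈ box n L, τ ξ / hermiteNormSq ξ *
    (pairE i p (ξ + Pi.single i a) (ξ + Pi.single i b) x y : ℂ)

lemma continuous_kernelSum (L : ℕ) (i : Fin n) (p a b : ℕ) (τ : MIdx n → ℂ) (x : Rn n) :
    Continuous (kernelSum L i p a b τ x) := by
  unfold kernelSum
  exact continuous_finsetSum _ fun ξ _ => continuous_const.mul
    (Complex.continuous_ofReal.comp (continuous_pairE _ _ _ _ _))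

lemma hermiteNormSq_add_single_le (L a : ℕ) (i : Fin n) {ξ : MIdx n} (hξ : ξ ∈ box n L) :
    hermiteNormSq (ξ + Pi.single i a) ≤ (2 * (a + 1) * (L + 1)) ^ a * hermiteNormSq ξ := by
  have h : ∀ m ≤ a, hermiteNormSq (ξ + Pi.single i m) ≤
      (2 * (a + 1) * (L + 1)) ^ m * hermiteNormSq ξ := by
    intro m hm
    induction m with
    | zero => simp
    | succ m ih =>
      have e : ξ + Pi.single i (m + 1) = ξ + Pi.single i m + Pi.single i 1 := by
        rw [Pi.single_add, add_assoc]
      have hN := hermiteNormSq_pos ξ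
      rw [e, hermiteNormSq_add_single, pow_succ',
        mul_assoc (2 * ((a : ℝ) + 1) * (L + 1))]
      refine mul_le_mul ?_ (ih (by omega)) (hermiteNormSq_pos _).le (by positivity)
      have h1 : (ξ i : ℝ) ≤ L := by exact_mod_cast mem_box.1 hξ i
      have h2 : (m : ℝ) + 1 ≤ a := by exact_mod_cast hm
      simp only [Pi.add_apply, Pi.single_eq_same, Nat.cast_add]
      have : (0 : ℝ) ≤ a * L := by positivity
      nlinarith
  exact h a le_rfl

lemma sum_sq_hermiteE_add_single_le (L a : ℕ) (i : Fin n) (x : Rn n) :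
    ∑ ξ ∈ box n L, hermiteE (ξ + Pi.single i a) x ^ 2 / hermiteNormSq (ξ + Pi.single i a) ≤
      Real.sqrt (2 * (a + 1)) ^ n * Real.sqrt (L + 1) ^ n := by
  have hsub : (box n L).map ⟨fun ξ => ξ + Pi.single i a, add_left_injective _⟩ ⊆ box n (L + a) := by
    intro η hη
    obtain ⟨ξ, hξ, rfl⟩ := Finset.mem_map.1 hη
    refine mem_box.2 fun j => ?_
    have := mem_box.1 hξ j
    by_cases hj : j = i
    · subst hj; simpa using this
    · simp [hj]; omega
  have h1 := Finset.sum_le_sum_of_subset_of_nonneg hsub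
    (f := fun η => hermiteE η x ^ 2 / hermiteNormSq η) fun η _ _ => by
      have := hermiteNormSq_pos η; positivity
  rw [Finset.sum_map] at h1
  refine (h1.trans (sum_sq_hermiteE_le (L + a) x)).trans ?_
  rw [← mul_pow, ← Real.sqrt_mul (by positivity)]
  refine pow_le_pow_left₀ (Real.sqrt_nonneg _) (Real.sqrt_le_sqrt ?_) n
  push_cast
  have : (0 : ℝ) ≤ a * L := by positivity
  nlinarith

/-- Parseval's identity in `y` reduces this to the pointwise bound on `∑ h_ξ(x)²`. Every raising
operator or shift contributes a factor of order `L` to the square of the norm. -/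
lemma exists_lintegral_kernelSum_le (n p : ℕ) : ∀ a b : ℕ, ∃ C : ℝ, 0 ≤ C ∧
    ∀ (L : ℕ) (i : Fin n) (x : Rn n) (τ : MIdx n → ℂ) (A : ℝ), (∀ ξ, ‖τ ξ‖ ≤ A) →
      ∫⁻ y, ‖kernelSum L i p a b τ x y‖ₑ ^ 2 ≤
        ENNReal.ofReal (C * A ^ 2 * (L + 1) ^ (p + a + b) * Real.sqrt (L + 1) ^ n) := by
  induction p with
  | zero =>
    intro a b
    refine ⟨(2 * (a + 1)) ^ a * (2 * (b + 1)) ^ b * Real.sqrt (2 * (a + 1)) ^ n, by positivity,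
      fun L i x τ A hA => ?_⟩
    have e : ∀ y, kernelSum L i 0 a b τ x y = ∑ ξ ∈ box n L,
        (τ ξ / hermiteNormSq ξ * (hermiteE (ξ + Pi.single i a) x : ℂ)) *
          (hermiteE (ξ + Pi.single i b) y : ℂ) := fun y => by
      simp only [kernelSum, pairE]
      push_cast
      exact Finset.sum_congr rfl fun ξ _ => by ring
    simp_rw [e]
    have hP := lintegral_enorm_sq_sum_hermiteE (box n L) (fun ξ => ξ + Pi.single i b)
      (add_left_injective _) (fun ξ => τ ξ / hermiteNormSq ξ *
        (hermiteE (ξ + Pi.single i a) x : ℂ))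
    rw [hP]
    apply ENNReal.ofReal_le_ofReal
    have hterm : ∀ ξ ∈ box n L,
        ‖τ ξ / hermiteNormSq ξ * (hermiteE (ξ + Pi.single i a) x : ℂ)‖ ^ 2 *
          hermiteNormSq (ξ + Pi.single i b) ≤
        (A ^ 2 * (2 * (a + 1) * (L + 1)) ^ a * (2 * (b + 1) * (L + 1)) ^ b) *
          (hermiteE (ξ + Pi.single i a) x ^ 2 / hermiteNormSq (ξ + Pi.single i a)) := by
      intro ξ hξ
      have hN := hermiteNormSq_pos ξ
      have hNa := hermiteNormSq_pos (ξ + Pi.single i a)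
      have hNb := hermiteNormSq_pos (ξ + Pi.single i b)
      have ha := hermiteNormSq_add_single_le L a i hξ
      have hb := hermiteNormSq_add_single_le L b i hξ
      rw [norm_mul, norm_div, mul_pow, div_pow, Complex.norm_real, Complex.norm_real,
        Real.norm_eq_abs, Real.norm_eq_abs, sq_abs, sq_abs]
      set E2 := hermiteE (ξ + Pi.single i a) x ^ 2 with hE2
      have hE0 : 0 ≤ E2 := sq_nonneg _
      calc _ ≤ A ^ 2 / hermiteNormSq ξ ^ 2 * E2 *
            ((2 * (b + 1) * (L + 1)) ^ b * hermiteNormSq ξ) := by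
            gcongr; exact hA ξ
        _ = A ^ 2 * (2 * (b + 1) * (L + 1)) ^ b * (E2 / hermiteNormSq ξ) := by
            field_simp
        _ ≤ A ^ 2 * (2 * (b + 1) * (L + 1)) ^ b * (E2 *
            ((2 * (a + 1) * (L + 1)) ^ a / hermiteNormSq (ξ + Pi.single i a))) := by
            rw [div_eq_mul_inv E2]
            gcongr
            rw [le_div_iff₀ hNa, inv_mul_le_iff₀ hN, mul_comm]
            exact ha
        _ = _ := by ring
    refine (Finset.sum_le_sum hterm).trans ?_
    rw [← Finset.mul_sum]
    refine (mul_le_mul_of_nonneg_left (sum_sq_hermiteE_add_single_le L a i x)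
      (by positivity)).trans_eq ?_
    simp only [mul_pow, pow_add, pow_zero]; ring
  | succ p ih =>
    intro a b
    obtain ⟨C1, hC1, h1⟩ := ih a (b + 1)
    obtain ⟨C2, hC2, h2⟩ := ih (a + 1) b
    refine ⟨2 * C1 + 2 * C2, by positivity, fun L i x τ A hA => ?_⟩
    have e : ∀ y, kernelSum L i (p + 1) a b τ x y =
        kernelSum L i p a (b + 1) τ x y - kernelSum L i p (a + 1) b τ x y := fun y => by
      simp only [kernelSum, pairE, ← Finset.sum_sub_distrib, Pi.single_add, ← add_assoc]
      push_cast
      exact Finset.sum_congr rfl fun ξ _ => by ring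
    simp_rw [e]
    refine (lintegral_enorm_sq_sub_le
      (continuous_kernelSum L i p a (b + 1) τ x).aemeasurable).trans ?_
    refine (add_le_add (mul_le_mul_right (h1 L i x τ A hA) 2)
      (mul_le_mul_right (h2 L i x τ A hA) 2)).trans_eq ?_
    rw [show (2 : ℝ≥0∞) = ENNReal.ofReal 2 by simp, ← ENNReal.ofReal_mul (by norm_num),
      ← ENNReal.ofReal_mul (by norm_num), ← ENNReal.ofReal_add (by positivity) (by positivity)]
    congr 1
    ring

lemma sum_box_add_single (L : ℕ) (i : Fin n) (G : MIdx n → ℂ) (hG : ∀ ξ ∉ box n L, G ξ = 0)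
    (h0 : ∀ ξ, ξ i = 0 → G ξ = 0) :
    ∑ ξ ∈ box n L, G ξ = ∑ ξ ∈ box n L, G (ξ + Pi.single i 1) := by
  have h1 : ∑' ξ, G ξ = ∑ ξ ∈ box n L, G ξ := tsum_eq_sum hG
  have h2 : ∑' ξ, G (ξ + Pi.single i 1) = ∑ ξ ∈ box n L, G (ξ + Pi.single i 1) :=
    tsum_eq_sum fun ξ hξ => hG _ fun h =>
      hξ (mem_box.2 fun j => le_trans (by simp) (mem_box.1 h j))
  rw [← h1, ← h2]
  exact ((add_left_injective (Pi.single i 1)).tsum_eq fun ξ hξ =>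
    ⟨ξ - Pi.single i 1, sub_add_single fun h => hξ (h0 ξ h)⟩).symm

lemma add_single_notMem_box {L : ℕ} (i : Fin n) {ξ : MIdx n} (hξ : ξ ∉ box n L) :
    ξ + Pi.single i 1 ∉ box n L :=
  fun h => hξ (mem_box.2 fun j => le_trans (by simp) (mem_box.1 h j))

/-- Multiplication of the kernel by `xᵢ - yᵢ` turns into a difference of its symbol (summation by
parts), up to a term with one raising operator less. -/
lemma sub_mul_kernelSum (L : ℕ) (i : Fin n) (p : ℕ) (τ : MIdx n → ℂ)
    (hτ : ∀ ξ ∉ box n L, τ ξ = 0) (x y : Rn n) :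
    ((x i - y i : ℝ) : ℂ) * kernelSum L i p 0 0 τ x y =
      1 / 2 * kernelSum L i (p + 1) 0 0 (partialDiff i τ) x y -
        2 * p * kernelSum L i (p - 1) 0 0 τ x y := by
  have hterm : ∀ ξ : MIdx n, ((x i - y i : ℝ) : ℂ) * (pairE i p ξ ξ x y : ℂ) =
      -(1 / 2) * (pairE i (p + 1) ξ ξ x y : ℂ) +
        (ξ i : ℂ) * (pairE i (p + 1) (ξ - Pi.single i 1) (ξ - Pi.single i 1) x y : ℂ) -
        2 * p * (pairE i (p - 1) ξ ξ x y : ℂ) := fun ξ => by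
    have h := sub_mul_pairE i p ξ ξ x y
    have h2 : (ξ i : ℝ) * pairE i (p + 1) (ξ - Pi.single i 1) (ξ - Pi.single i 1) x y =
        ξ i * (pairE i p (ξ - Pi.single i 1) ξ x y - pairE i p ξ (ξ - Pi.single i 1) x y) := by
      by_cases h : ξ i = 0
      · simp [h]
      · rw [pairE, sub_add_single h]
    have h3 : (x i - y i) * pairE i p ξ ξ x y = -(1 / 2) * pairE i (p + 1) ξ ξ x y +
        ξ i * pairE i (p + 1) (ξ - Pi.single i 1) (ξ - Pi.single i 1) x y -
        2 * p * pairE i (p - 1) ξ ξ x y := by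
      rw [h, h2, pairE]; ring
    have h4 := congrArg (fun r : ℝ => (r : ℂ)) h3
    push_cast at h4 ⊢
    exact h4
  have hshift := sum_box_add_single L i (fun ξ => τ ξ / hermiteNormSq ξ *
    ((ξ i : ℂ) * (pairE i (p + 1) (ξ - Pi.single i 1) (ξ - Pi.single i 1) x y : ℂ)))
    (fun ξ hξ => by simp [hτ ξ hξ]) (fun ξ hξ => by simp [hξ])
  simp only [kernelSum, Pi.single_zero, add_zero]
  rw [Finset.mul_sum, Finset.mul_sum, Finset.mul_sum]
  have hsplit : ∀ ξ : MIdx n, ((x i - y i : ℝ) : ℂ) *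
      (τ ξ / hermiteNormSq ξ * (pairE i p ξ ξ x y : ℂ)) =
      -(1 / 2) * (τ ξ / hermiteNormSq ξ * (pairE i (p + 1) ξ ξ x y : ℂ)) +
      τ ξ / hermiteNormSq ξ * ((ξ i : ℂ) *
        (pairE i (p + 1) (ξ - Pi.single i 1) (ξ - Pi.single i 1) x y : ℂ)) -
      2 * p * (τ ξ / hermiteNormSq ξ * (pairE i (p - 1) ξ ξ x y : ℂ)) := fun ξ => by
    linear_combination (τ ξ / hermiteNormSq ξ) * hterm ξ
  simp_rw [hsplit]
  rw [Finset.sum_sub_distrib, Finset.sum_add_distrib, hshift, ← Finset.sum_add_distrib]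
  congr 1
  refine Finset.sum_congr rfl fun ξ _ => ?_
  have hN : (hermiteNormSq ξ : ℂ) ≠ 0 := by exact_mod_cast (hermiteNormSq_pos ξ).ne'
  have hs : ((ξ i : ℂ) + 1) ≠ 0 := by exact_mod_cast Nat.succ_ne_zero (ξ i)
  rw [hermiteNormSq_add_single, add_tsub_cancel_right]
  simp only [partialDiff, Pi.add_apply, Pi.single_eq_same]
  push_cast
  field_simp
  ring

/-- Multiplication of the kernel by `xᵢ - yᵢ` gains a factor of order `L^{-1/2}` in norm: a
difference of the symbol gains `L^{-1}`, and the raising operator that comes with it costs `L^{1/2}`. -/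
lemma exists_lintegral_weighted_kernelSum_le (n N : ℕ) : ∀ p : ℕ, ∃ C : ℝ, 0 ≤ C ∧
    ∀ (L : ℕ) (i : Fin n) (x : Rn n) (τ : MIdx n → ℂ) (A : ℝ), (∀ ξ ∉ box n L, τ ξ = 0) →
      (∀ l ≤ N, ∀ ξ, ‖(partialDiff i)^[l] τ ξ‖ ≤ A / (L + 1) ^ l) →
      ∫⁻ y, ‖((x i - y i : ℝ) : ℂ) ^ N * kernelSum L i p 0 0 τ x y‖ₑ ^ 2 ≤
        ENNReal.ofReal (C * A ^ 2 * (L + 1) ^ p / (L + 1) ^ N * Real.sqrt (L + 1) ^ n) := by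
  induction N with
  | zero =>
    intro p
    obtain ⟨C, hC, h⟩ := exists_lintegral_kernelSum_le n p 0 0
    refine ⟨C, hC, fun L i x τ A _ hA => ?_⟩
    have := h L i x τ A fun ξ => by simpa using hA 0 le_rfl ξ
    simpa using this
  | succ N ih =>
    intro p
    obtain ⟨C1, hC1, h1⟩ := ih (p + 1)
    obtain ⟨C2, hC2, h2⟩ := ih (p - 1)
    refine ⟨1 / 2 * C1 + 8 * p ^ 2 * C2, by positivity, fun L i x τ A hτ hA => ?_⟩
    have b1 := h1 L i x (partialDiff i τ) (A / (L + 1))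
      (fun ξ hξ => by simp [partialDiff, hτ ξ hξ, hτ _ (add_single_notMem_box i hξ)])
      (fun l hl ξ => by
        have := hA (l + 1) (by omega) ξ
        rw [Function.iterate_succ_apply] at this
        rwa [div_div, ← pow_succ'])
    have b2 := h2 L i x τ A hτ (fun l hl ξ => hA l (by omega) ξ)
    have e : ∀ y, ((x i - y i : ℝ) : ℂ) ^ (N + 1) * kernelSum L i p 0 0 τ x y =
        1 / 2 * (((x i - y i : ℝ) : ℂ) ^ N * kernelSum L i (p + 1) 0 0 (partialDiff i τ) x y) -
        2 * p * (((x i - y i : ℝ) : ℂ) ^ N * kernelSum L i (p - 1) 0 0 τ x y) := fun y => by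
      rw [pow_succ, mul_assoc, sub_mul_kernelSum L i p τ hτ x y]; ring
    simp_rw [e]
    have hm : Continuous fun y : Rn n => 1 / 2 * (((x i - y i : ℝ) : ℂ) ^ N *
        kernelSum L i (p + 1) 0 0 (partialDiff i τ) x y) := by
      have := continuous_kernelSum L i (p + 1) 0 0 (partialDiff i τ) x
      fun_prop
    refine (lintegral_enorm_sq_sub_le hm.aemeasurable).trans ?_
    rw [lintegral_enorm_sq_const_mul, lintegral_enorm_sq_const_mul]
    have b2' : ENNReal.ofReal (‖(2 * p : ℂ)‖ ^ 2) *
        ∫⁻ y, ‖((x i - y i : ℝ) : ℂ) ^ N * kernelSum L i (p - 1) 0 0 τ x y‖ₑ ^ 2 ≤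
        ENNReal.ofReal (4 * p ^ 2 *
          (C2 * A ^ 2 * (L + 1) ^ p / (L + 1) ^ (N + 1) * Real.sqrt (L + 1) ^ n)) := by
      rcases p with _ | p
      · simp
      · refine (mul_le_mul_right b2 _).trans_eq ?_
        rw [← ENNReal.ofReal_mul (by positivity)]
        congr 1
        have : ‖(2 * (p + 1 : ℕ) : ℂ)‖ = 2 * (p + 1 : ℕ) := by
          rw [norm_mul, Complex.norm_natCast]; simp
        rw [this]
        simp only [Nat.add_sub_cancel]
        field_simp
        ring
    refine (add_le_add (mul_le_mul_right (mul_le_mul_right b1 _) 2)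
      (mul_le_mul_right b2' 2)).trans_eq ?_
    rw [show (2 : ℝ≥0∞) = ENNReal.ofReal 2 by simp, ← ENNReal.ofReal_mul (by positivity),
      ← ENNReal.ofReal_mul (by norm_num), ← ENNReal.ofReal_mul (by norm_num),
      ← ENNReal.ofReal_add (by positivity) (by positivity)]
    congr 1
    have : ‖(1 / 2 : ℂ)‖ = 1 / 2 := by simp
    rw [this]
    field_simp
    ring

/-! ### Uniform bounds on dyadic blocks -/

/-- The polynomial weight `1 + ∑ᵢ zᵢ^{2K}`. -/
def polyWeight (K : ℕ) (z : Rn n) : ℝ := 1 + ∑ i, z i ^ (2 * K)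

lemma one_le_polyWeight (K : ℕ) (z : Rn n) : 1 ≤ polyWeight K z := by
  have : 0 ≤ ∑ i, z i ^ (2 * K) :=
    Finset.sum_nonneg fun i _ => by rw [pow_mul]; positivity
  unfold polyWeight; linarith

lemma continuous_polyWeight (K : ℕ) : Continuous (polyWeight K : Rn n → ℝ) := by
  unfold polyWeight; fun_prop

lemma integrable_inv_polyWeight {K : ℕ} (hK : n < 2 * K) :
    Integrable fun z : Rn n => (polyWeight K z)⁻¹ := by
  have hK0 : K ≠ 0 := by omega
  have hint : Integrable fun z : Rn n => (1 + ‖z‖) ^ (-((2 * K : ℕ) : ℝ)) :=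
    integrable_one_add_norm (by simpa using mod_cast hK)
  refine (hint.const_mul (2 ^ (2 * K) * (1 + (n : ℝ) ^ K))).mono'
    ((continuous_polyWeight K).inv₀ fun z =>
      (zero_lt_one.trans_le (one_le_polyWeight K z)).ne').aestronglyMeasurable
    (Eventually.of_forall fun z => ?_)
  have hW := zero_lt_one.trans_le (one_le_polyWeight K z)
  have hz : 0 < 1 + ‖z‖ := by positivity
  rw [Real.norm_of_nonneg (inv_nonneg.2 hW.le), Real.rpow_neg hz.le, Real.rpow_natCast,
    ← div_eq_mul_inv, inv_eq_one_div, div_le_div_iff₀ hW (by positivity), one_mul]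
  have h1 : (‖z‖ ^ 2) ^ K ≤ (n : ℝ) ^ K * ∑ i, z i ^ (2 * K) := by
    obtain ⟨k, rfl⟩ := Nat.exists_eq_succ_of_ne_zero hK0
    have h := pow_sum_div_card_le_sum_pow (s := Finset.univ) (f := fun i => z i ^ 2) (n := k)
      (fun i _ => sq_nonneg (z i))
    have h0 : 0 ≤ ∑ i, z i ^ (2 * (k + 1)) :=
      Finset.sum_nonneg fun i _ => by rw [pow_mul]; positivity
    simp_rw [← pow_mul, Finset.card_univ, Fintype.card_fin] at h
    rw [EuclideanSpace.real_norm_sq_eq]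
    rcases Nat.eq_zero_or_pos n with hn | hn
    · subst hn; simp
    · have hn' : (1 : ℝ) ≤ n := by exact_mod_cast hn
      rw [div_le_iff₀ (by positivity)] at h
      refine h.trans ?_
      rw [mul_comm]
      gcongr
      exact Nat.le_succ k
  have h2 : (1 + ‖z‖) ^ (2 * K) ≤ 2 ^ (2 * K) * (1 + (‖z‖ ^ 2) ^ K) := by
    rw [← pow_mul]
    rcases le_total ‖z‖ 1 with h | h
    · calc (1 + ‖z‖) ^ (2 * K) ≤ 2 ^ (2 * K) := by gcongr; linarith
        _ ≤ _ := le_mul_of_one_le_right (by positivity) (by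
          have : 0 ≤ ‖z‖ ^ (2 * K) := by positivity
          linarith)
    · calc (1 + ‖z‖) ^ (2 * K) ≤ (2 * ‖z‖) ^ (2 * K) := by gcongr; linarith
        _ ≤ _ := by rw [mul_pow]; gcongr; linarith
  refine h2.trans ?_
  rw [mul_assoc]
  gcongr
  have h3 : 0 ≤ ∑ i, z i ^ (2 * K) := Finset.sum_nonneg fun i _ => by rw [pow_mul]; positivity
  have h4 : (0 : ℝ) ≤ n ^ K := by positivity
  unfold polyWeight
  nlinarith

lemma sq_lintegral_mul_le {α : Type*} [MeasurableSpace α] {μ : Measure α} {f g : α → ℝ≥0∞}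
    (hf : AEMeasurable f μ) (hg : AEMeasurable g μ) :
    (∫⁻ a, f a * g a ∂μ) ^ 2 ≤ (∫⁻ a, f a ^ 2 ∂μ) * ∫⁻ a, g a ^ 2 ∂μ := by
  have h := ENNReal.lintegral_mul_le_Lp_mul_Lq μ
    (Real.HolderConjugate.two_two) hf hg
  simp only [Pi.mul_apply] at h
  refine (pow_le_pow_left' h 2).trans_eq ?_
  rw [mul_pow, ← ENNReal.rpow_natCast, ← ENNReal.rpow_mul, ← ENNReal.rpow_natCast,
    ← ENNReal.rpow_mul]
  simp

lemma lintegral_enorm_sq_sum_hermiteFun (s : Finset (MIdx n)) (c : MIdx n → ℂ) :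
    ∫⁻ y, ‖∑ ξ ∈ s, c ξ * (hermiteFun ξ y : ℂ)‖ₑ ^ 2 =
      ENNReal.ofReal (∑ ξ ∈ s, ‖c ξ‖ ^ 2) := by
  have h := lintegral_enorm_sq_sum_hermiteE s (fun ξ : MIdx n => ξ) Function.injective_id
    (fun ξ => c ξ * ((Real.sqrt (hermiteNormSq ξ))⁻¹ : ℝ))
  have e1 : ∀ y, ∑ ξ ∈ s, c ξ * (hermiteFun ξ y : ℂ) =
      ∑ ξ ∈ s, c ξ * ((Real.sqrt (hermiteNormSq ξ))⁻¹ : ℝ) * (hermiteE ξ y : ℂ) := fun y =>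
    Finset.sum_congr rfl fun ξ _ => by rw [hermiteFun_eq]; push_cast; ring
  simp_rw [e1]
  rw [h]
  congr 1
  refine Finset.sum_congr rfl fun ξ _ => ?_
  have hN := hermiteNormSq_pos ξ
  rw [norm_mul, Complex.norm_real, Real.norm_eq_abs, mul_pow, sq_abs, inv_pow,
    Real.sq_sqrt hN.le]
  field_simp

/-- Multiplication by the dilated weight in the second variable of the kernel. -/
lemma exists_lintegral_kernelSum_polyWeight_le (n K : ℕ) : ∃ C : ℝ, 0 ≤ C ∧
    ∀ (L : ℕ) (i : Fin n) (x : Rn n) (τ : MIdx n → ℂ) (A : ℝ), (∀ ξ ∉ box n L, τ ξ = 0) →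
      (∀ i, ∀ l ≤ K, ∀ ξ, ‖(partialDiff i)^[l] τ ξ‖ ≤ A / (L + 1) ^ l) →
      ∫⁻ y, ‖kernelSum L i 0 0 0 τ x y‖ₑ ^ 2 *
        ENNReal.ofReal (polyWeight K (Real.sqrt (L + 1) • (x - y))) ≤
        ENNReal.ofReal (C * A ^ 2 * Real.sqrt (L + 1) ^ n) := by
  obtain ⟨C0, hC0, h0⟩ := exists_lintegral_kernelSum_le n 0 0 0
  obtain ⟨C1, hC1, h1⟩ := exists_lintegral_weighted_kernelSum_le n K 0
  refine ⟨C0 + n * C1, by positivity, fun L i x τ A hτ hA => ?_⟩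
  have b0 := h0 L i x τ A fun ξ => by simpa using hA i 0 (Nat.zero_le _) ξ
  have hk : ∀ j y, kernelSum L j 0 0 0 τ x y = kernelSum L i 0 0 0 τ x y := fun j y => by
    simp [kernelSum, pairE]
  have e : ∀ y, ‖kernelSum L i 0 0 0 τ x y‖ₑ ^ 2 *
      ENNReal.ofReal (polyWeight K (Real.sqrt (L + 1) • (x - y))) =
      ‖kernelSum L i 0 0 0 τ x y‖ₑ ^ 2 + ∑ j, ENNReal.ofReal ((L + 1) ^ K) *
        ‖((x j - y j : ℝ) : ℂ) ^ K * kernelSum L j 0 0 0 τ x y‖ₑ ^ 2 := fun y => by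
    rw [polyWeight, ENNReal.ofReal_add zero_le_one
      (Finset.sum_nonneg fun i _ => by rw [pow_mul]; positivity), ENNReal.ofReal_one, mul_add,
      mul_one, ENNReal.ofReal_sum_of_nonneg (fun i _ => by rw [pow_mul]; positivity),
      Finset.mul_sum]
    congr 1
    refine Finset.sum_congr rfl fun j _ => ?_
    have e1 : (Real.sqrt (L + 1) • (x - y)) j ^ (2 * K) = (L + 1) ^ K * (|x j - y j| ^ K) ^ 2 := by
      simp only [PiLp.smul_apply, PiLp.sub_apply, smul_eq_mul, mul_pow]
      rw [pow_mul, Real.sq_sqrt (by positivity), ← pow_mul, mul_comm K 2, pow_mul, pow_mul, sq_abs]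
    rw [hk j, e1, ENNReal.ofReal_mul (by positivity), enorm_mul, enorm_pow, mul_pow,
      ENNReal.ofReal_pow (by positivity), ENNReal.ofReal_pow (pow_nonneg (abs_nonneg _) K),
      ENNReal.ofReal_pow (abs_nonneg _), ← ofReal_norm (((x j - y j : ℝ) : ℂ)), Complex.norm_real,
      Real.norm_eq_abs]
    ring
  have hmeas : ∀ j : Fin n, Measurable fun y : Rn n =>
      ‖((x j - y j : ℝ) : ℂ) ^ K * kernelSum L j 0 0 0 τ x y‖ₑ ^ 2 := fun j => by
    have := continuous_kernelSum L j 0 0 0 τ x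
    have h : Continuous fun y : Rn n =>
      ((x j - y j : ℝ) : ℂ) ^ K * kernelSum L j 0 0 0 τ x y := by fun_prop
    exact h.measurable.enorm.pow_const 2
  simp_rw [e]
  rw [lintegral_add_left ((continuous_kernelSum L i 0 0 0 τ x).measurable.enorm.pow_const 2),
    lintegral_finsetSum _ fun j _ => (hmeas j).const_mul _]
  simp_rw [lintegral_const_mul' _ _ ENNReal.ofReal_ne_top]
  refine (add_le_add b0 (Finset.sum_le_sum fun j _ =>
    mul_le_mul_right (h1 L j x τ A hτ (hA j)) _)).trans_eq ?_
  simp_rw [← ENNReal.ofReal_mul (show (0 : ℝ) ≤ (L + 1) ^ K by positivity)]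
  rw [← ENNReal.ofReal_sum_of_nonneg (fun _ _ => by positivity), ← ENNReal.ofReal_add
    (by positivity) (Finset.sum_nonneg fun _ _ => by positivity)]
  congr 1
  simp only [Finset.sum_const, Finset.card_univ, Fintype.card_fin, nsmul_eq_mul]
  field_simp
  ring

lemma integral_kernelSum_mul (L : ℕ) (i : Fin n) (τ c : MIdx n → ℂ) (x : Rn n) :
    ∫ y, kernelSum L i 0 0 0 τ x y * ∑ ξ ∈ box n L, c ξ * (hermiteFun ξ y : ℂ) =
      ∑ ξ ∈ box n L, τ ξ * c ξ * (hermiteFun ξ x : ℂ) := by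
  have e : ∀ y, kernelSum L i 0 0 0 τ x y * ∑ ξ ∈ box n L, c ξ * (hermiteFun ξ y : ℂ) =
      ∑ ξ ∈ box n L, ∑ η ∈ box n L, τ ξ / hermiteNormSq ξ * (hermiteE ξ x : ℂ) *
        (c η * ((Real.sqrt (hermiteNormSq η))⁻¹ : ℝ)) *
        ((hermiteE ξ y * hermiteE η y : ℝ) : ℂ) := fun y => by
    rw [kernelSum, Finset.sum_mul_sum]
    refine Finset.sum_congr rfl fun ξ _ => Finset.sum_congr rfl fun η _ => ?_
    rw [hermiteFun_eq]
    simp only [pairE, Pi.single_zero, add_zero]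
    push_cast
    ring
  have hi : ∀ ξ η : MIdx n, Integrable fun y => τ ξ / hermiteNormSq ξ * (hermiteE ξ x : ℂ) *
        (c η * ((Real.sqrt (hermiteNormSq η))⁻¹ : ℝ)) *
        ((hermiteE ξ y * hermiteE η y : ℝ) : ℂ) := fun ξ η =>
    ((integrable_hermiteE_mul ξ η).ofReal).const_mul _
  simp_rw [e]
  rw [integral_finsetSum _ fun ξ _ => integrable_finsetSum _ fun η _ => hi ξ η]
  refine Finset.sum_congr rfl fun ξ hξ => ?_
  rw [integral_finsetSum _ fun η _ => hi ξ η]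
  simp_rw [integral_const_mul, integral_complex_ofReal, integral_hermiteE_mul]
  rw [Finset.sum_eq_single ξ (fun η _ h => by simp [h.symm]) (fun h => absurd hξ h)]
  have hN : (hermiteNormSq ξ : ℂ) ≠ 0 := by exact_mod_cast (hermiteNormSq_pos ξ).ne'
  rw [hermiteFun_eq]
  push_cast
  simp only [if_true]
  field_simp

/-- Symbols that live at frequency scale `L` and whose differences of order `l` in each variable
decay like `L^{-l}` give operators that are bounded on `L²` uniformly in `L`. No regularity in `x`
is needed: the kernel is square integrable against a weight, by summation by parts. -/
theorem exists_block_bound {K : ℕ} (hn : 1 ≤ n) (hK : n < 2 * K) : ∃ C : ℝ, 0 ≤ C ∧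
    ∀ (L : ℕ) (τ : Rn n → MIdx n → ℂ) (A : ℝ), (∀ x, ∀ ξ ∉ box n L, τ x ξ = 0) →
      (∀ x i, ∀ l ≤ K, ∀ ξ, ‖(partialDiff i)^[l] (τ x) ξ‖ ≤ A / (L + 1) ^ l) →
      ∀ c : MIdx n → ℂ,
        ∫⁻ x, ‖∑ ξ ∈ box n L, τ x ξ * c ξ * (hermiteFun ξ x : ℂ)‖ₑ ^ 2 ≤
          ENNReal.ofReal (C * A ^ 2 * ∑ ξ ∈ box n L, ‖c ξ‖ ^ 2) := by
  obtain ⟨C, hC, h⟩ := exists_lintegral_kernelSum_polyWeight_le n K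
  set I : ℝ := ∫ z : Rn n, (polyWeight K z)⁻¹ with hI
  have hI0 : 0 ≤ I := integral_nonneg fun z =>
    inv_nonneg.2 (zero_le_one.trans (one_le_polyWeight K z))
  refine ⟨C * I, by positivity, fun L τ A hτ hA c => ?_⟩
  let i : Fin n := ⟨0, hn⟩
  set r : ℝ := Real.sqrt (L + 1) with hr
  have hr0 : 0 < r := Real.sqrt_pos.2 (by positivity)
  set f : Rn n → ℂ := fun y => ∑ ξ ∈ box n L, c ξ * (hermiteFun ξ y : ℂ) with hf
  have hfc : Continuous f := continuous_finsetSum _ fun ξ _ =>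
    continuous_const.mul (Complex.continuous_ofReal.comp (continuous_hermiteFun ξ))
  have hW : ∀ z : Rn n, 0 < polyWeight K z := fun z =>
    zero_lt_one.trans_le (one_le_polyWeight K z)
  have hpt : ∀ x, ‖∑ ξ ∈ box n L, τ x ξ * c ξ * (hermiteFun ξ x : ℂ)‖ₑ ^ 2 ≤
      ENNReal.ofReal (C * A ^ 2 * r ^ n) *
        ∫⁻ y, ‖f y‖ₑ ^ 2 * ENNReal.ofReal (polyWeight K (r • (x - y)))⁻¹ := by
    intro x
    have hWc : Continuous fun y => Real.sqrt (polyWeight K (r • (x - y))) :=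
      Real.continuous_sqrt.comp ((continuous_polyWeight K).comp (by fun_prop))
    have hu := continuous_kernelSum L i 0 0 0 (τ x) x
    have hs : ∀ y, 0 < Real.sqrt (polyWeight K (r • (x - y))) := fun y =>
      Real.sqrt_pos.2 (hW _)
    rw [← integral_kernelSum_mul L i (τ x) c x]
    calc _ ≤ (∫⁻ y, ‖kernelSum L i 0 0 0 (τ x) x y * f y‖ₑ) ^ 2 := by
          gcongr; exact enorm_integral_le_lintegral_enorm _
      _ = (∫⁻ y, (‖kernelSum L i 0 0 0 (τ x) x y‖ₑ *
            ENNReal.ofReal (Real.sqrt (polyWeight K (r • (x - y))))) *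
            (‖f y‖ₑ * ENNReal.ofReal (Real.sqrt (polyWeight K (r • (x - y))))⁻¹)) ^ 2 := by
          congr 1
          refine lintegral_congr fun y => ?_
          rw [enorm_mul, mul_mul_mul_comm, ← ENNReal.ofReal_mul (hs y).le,
            mul_inv_cancel₀ (hs y).ne', ENNReal.ofReal_one, mul_one]
      _ ≤ _ := sq_lintegral_mul_le
          (hu.measurable.enorm.mul hWc.measurable.ennreal_ofReal).aemeasurable
          (hfc.measurable.enorm.mul hWc.measurable.inv.ennreal_ofReal).aemeasurable
      _ ≤ _ := by
          refine mul_le_mul' ?_ (le_of_eq ?_)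
          · refine le_trans (le_of_eq ?_) (h L i x (τ x) A (hτ x) (hA x))
            refine lintegral_congr fun y => ?_
            rw [mul_pow, ← ENNReal.ofReal_pow (hs y).le, Real.sq_sqrt (hW _).le]
          · refine lintegral_congr fun y => ?_
            rw [mul_pow, ← ENNReal.ofReal_pow (inv_nonneg.2 (hs y).le), inv_pow,
              Real.sq_sqrt (hW _).le]
  -- The dilation of the weight produces `r^{-n}`, which cancels the `r^n` from the kernel bound.
  have hint : ∀ y : Rn n, ∫⁻ x, ENNReal.ofReal (polyWeight K (r • (x - y)))⁻¹ =
      ENNReal.ofReal ((r ^ n)⁻¹ * I) := by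
    intro y
    rw [lintegral_sub_right_eq_self (fun x => ENNReal.ofReal (polyWeight K (r • x))⁻¹) y,
      ← ofReal_integral_eq_lintegral_ofReal ((integrable_inv_polyWeight hK).comp_smul hr0.ne')
        (Eventually.of_forall fun z => inv_nonneg.2 (hW _).le),
      Measure.integral_comp_smul volume (fun z : Rn n => (polyWeight K z)⁻¹) r]
    simp [abs_of_pos hr0, hI]
  refine (lintegral_mono hpt).trans ?_
  have hm : Measurable (Function.uncurry fun x y : Rn n =>
      ‖f y‖ₑ ^ 2 * ENNReal.ofReal (polyWeight K (r • (x - y)))⁻¹) := by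
    refine ((hfc.measurable.comp measurable_snd).enorm.pow_const 2).mul
      (Measurable.ennreal_ofReal (Measurable.inv (Continuous.measurable ?_)))
    exact (continuous_polyWeight K).comp (by fun_prop)
  rw [lintegral_const_mul' _ _ ENNReal.ofReal_ne_top,
    lintegral_lintegral_swap hm.aemeasurable]
  have hin : ∀ y, ∫⁻ x, ‖f y‖ₑ ^ 2 * ENNReal.ofReal (polyWeight K (r • (x - y)))⁻¹ =
      ENNReal.ofReal ((r ^ n)⁻¹ * I) * ‖f y‖ₑ ^ 2 := fun y => by
    rw [lintegral_const_mul' _ _ (by simp), hint y, mul_comm]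
  simp_rw [hin]
  rw [lintegral_const_mul' _ _ ENNReal.ofReal_ne_top, lintegral_enorm_sq_sum_hermiteFun,
    ← ENNReal.ofReal_mul (by positivity), ← ENNReal.ofReal_mul (by positivity)]
  refine ENNReal.ofReal_le_ofReal (le_of_eq ?_)
  field_simp

/-! ### Partial derivatives and bounds on them -/

lemma contDiff_partialDeriv (i : Fin n) {m : ℕ} {g : Rn n → ℂ}
    (hg : ContDiff ℝ ((m + 1 : ℕ) : WithTop ℕ∞) g) :
    ContDiff ℝ (m : WithTop ℕ∞) (partialDeriv i g) :=
  (hg.fderiv_right (m := (m : WithTop ℕ∞)) (by exact_mod_cast le_rfl)).clm_apply contDiff_const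

lemma contDiff_iterate_partialDeriv (i : Fin n) {m : ℕ} (k : ℕ) {g : Rn n → ℂ}
    (hg : ContDiff ℝ ((m + k : ℕ) : WithTop ℕ∞) g) :
    ContDiff ℝ (m : WithTop ℕ∞) ((partialDeriv i)^[k] g) := by
  induction k generalizing g with
  | zero => exact hg
  | succ k ih => exact ih (contDiff_partialDeriv i hg)

lemma partialDeriv_comm (i j : Fin n) {g : Rn n → ℂ} (hg : ContDiff ℝ 2 g) :
    partialDeriv i (partialDeriv j g) = partialDeriv j (partialDeriv i g) := by
  have hd : Differentiable ℝ (fderiv ℝ g) :=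
    (hg.fderiv_right (m := 1) (by norm_num)).differentiable (by norm_num)
  have h : ∀ (k l : Fin n) (x : Rn n), partialDeriv k (partialDeriv l g) x =
      fderiv ℝ (fderiv ℝ g) x (EuclideanSpace.single k 1) (EuclideanSpace.single l 1) := by
    intro k l x
    unfold partialDeriv
    rw [fderiv_clm_apply (hd x) (differentiableAt_const _)]
    simp
  ext x
  rw [h, h]
  exact (hg.contDiffAt.isSymmSndFDerivAt (by simp)).eq _ _

lemma partialDeriv_iterate_comm (i j : Fin n) (k : ℕ) {g : Rn n → ℂ}
    (hg : ContDiff ℝ ((k + 1 : ℕ) : WithTop ℕ∞) g) :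
    partialDeriv i ((partialDeriv j)^[k] g) = (partialDeriv j)^[k] (partialDeriv i g) := by
  induction k generalizing g with
  | zero => rfl
  | succ k ih =>
    rw [Function.iterate_succ_apply, Function.iterate_succ_apply,
      ih (contDiff_partialDeriv j hg),
      partialDeriv_comm i j (hg.of_le (by exact_mod_cast Nat.le_add_left 2 k))]

lemma contDiff_foldr_partialDeriv (l : List (Fin n)) (ν : MIdx n) {m : ℕ} {g : Rn n → ℂ}
    (hg : ContDiff ℝ ((m + (l.map ν).sum : ℕ) : WithTop ℕ∞) g) :
    ContDiff ℝ (m : WithTop ℕ∞) (l.foldr (fun i g => (partialDeriv i)^[ν i] g) g) := by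
  induction l generalizing m with
  | nil => simpa using hg
  | cons j l ih =>
    refine contDiff_iterate_partialDeriv j (ν j) (ih ?_)
    simpa [add_assoc] using hg

lemma partialDeriv_foldr (i : Fin n) (l : List (Fin n)) (hl : l.Nodup) (hi : i ∈ l) (ν : MIdx n)
    {g : Rn n → ℂ} (hg : ContDiff ℝ (((l.map ν).sum + 1 : ℕ) : WithTop ℕ∞) g) :
    partialDeriv i (l.foldr (fun i g => (partialDeriv i)^[ν i] g) g) =
      l.foldr (fun j g => (partialDeriv j)^[(ν + Pi.single i 1 : MIdx n) j] g) g := by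
  induction l with
  | nil => simp at hi
  | cons j l ih =>
    obtain ⟨hj, hl⟩ := List.nodup_cons.1 hl
    simp only [List.foldr_cons]
    by_cases hij : j = i
    · subst hij
      have e : l.foldr (fun k g => (partialDeriv k)^[(ν + Pi.single j 1 : MIdx n) k] g) g =
          l.foldr (fun k g => (partialDeriv k)^[ν k] g) g := by
        refine List.foldr_ext _ _ _ fun k hk b => ?_
        have : k ≠ j := fun h => hj (h ▸ hk)
        simp [this]
      rw [e, Pi.add_apply, Pi.single_eq_same, Function.iterate_succ_apply']
    · have hil : i ∈ l := (List.mem_cons.1 hi).resolve_left fun h => hij h.symm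
      have hc : ContDiff ℝ ((ν j + 1 : ℕ) : WithTop ℕ∞)
          (l.foldr (fun i g => (partialDeriv i)^[ν i] g) g) := by
        refine contDiff_foldr_partialDeriv l ν (hg.of_le ?_)
        simp only [List.map_cons, List.sum_cons]
        exact_mod_cast (by omega : ν j + 1 + (l.map ν).sum ≤ ν j + (l.map ν).sum + 1)
      rw [partialDeriv_iterate_comm i j (ν j) hc, ih hl hil (hg.of_le ?_)]
      · simp [hij]
      · simp only [List.map_cons, List.sum_cons]
        exact_mod_cast (by omega : (l.map ν).sum + 1 ≤ ν j + (l.map ν).sum + 1)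

lemma len_eq_sum_finRange (ν : MIdx n) : ((List.finRange n).map ν).sum = ν.len := by
  rw [MIdx.len, ← List.ofFn_eq_map, List.sum_ofFn]

lemma contDiff_multiDeriv (ν : MIdx n) {m : ℕ} {g : Rn n → ℂ}
    (hg : ContDiff ℝ ((m + ν.len : ℕ) : WithTop ℕ∞) g) :
    ContDiff ℝ (m : WithTop ℕ∞) (multiDeriv ν g) :=
  contDiff_foldr_partialDeriv _ ν (by rwa [len_eq_sum_finRange])

lemma partialDeriv_multiDeriv (i : Fin n) (ν : MIdx n) {g : Rn n → ℂ}
    (hg : ContDiff ℝ ((ν.len + 1 : ℕ) : WithTop ℕ∞) g) :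
    partialDeriv i (multiDeriv ν g) = multiDeriv (ν + Pi.single i 1) g :=
  partialDeriv_foldr i _ (List.nodup_finRange n) (List.mem_finRange i) ν
    (by rwa [len_eq_sum_finRange])

lemma multiDeriv_zero (g : Rn n → ℂ) : multiDeriv 0 g = g := by
  unfold multiDeriv
  induction List.finRange n with
  | nil => rfl
  | cons j l ih => simp

/-- `DerivBound M a A R`: all partial derivatives of `a` of order `m ≤ M`, taken in any order, are
bounded by `A R^m`. -/
def DerivBound : ℕ → (Rn n → ℂ) → ℝ → ℝ → Prop
  | 0, a, A, _ => Continuous a ∧ ∀ x, ‖a x‖ ≤ A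
  | M + 1, a, A, R => Differentiable ℝ a ∧ (∀ x, ‖a x‖ ≤ A) ∧
      ∀ i, DerivBound M (partialDeriv i a) (A * R) R

namespace DerivBound

variable {M : ℕ} {a b : Rn n → ℂ} {A B R : ℝ}

lemma norm_le (h : DerivBound M a A R) (x : Rn n) : ‖a x‖ ≤ A := by
  cases M with
  | zero => exact h.2 x
  | succ M => exact h.2.1 x

lemma nonneg (h : DerivBound M a A R) : 0 ≤ A := (norm_nonneg _).trans (h.norm_le 0)

lemma continuous (h : DerivBound M a A R) : Continuous a := by
  cases M with
  | zero => exact h.1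
  | succ M => exact h.1.continuous

lemma of_succ (h : DerivBound (M + 1) a A R) : DerivBound M a A R := by
  induction M generalizing a A with
  | zero => exact ⟨h.continuous, h.norm_le⟩
  | succ M ih => exact ⟨h.1, h.2.1, fun i => ih (h.2.2 i)⟩

lemma mono {A' R' : ℝ} (h : DerivBound M a A R) (hA : A ≤ A') (hR : R ≤ R') (hR0 : 0 ≤ R) :
    DerivBound M a A' R' := by
  induction M generalizing a A A' with
  | zero => exact ⟨h.1, fun x => (h.2 x).trans hA⟩
  | succ M ih =>
    exact ⟨h.1, fun x => (h.2.1 x).trans hA, fun i =>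
      ih (h.2.2 i) (mul_le_mul hA hR hR0 (h.nonneg.trans hA))⟩

lemma add (ha : DerivBound M a A R) (hb : DerivBound M b B R) :
    DerivBound M (fun x => a x + b x) (A + B) R := by
  induction M generalizing a b A B with
  | zero => exact ⟨ha.1.add hb.1, fun x => (norm_add_le _ _).trans (add_le_add (ha.2 x) (hb.2 x))⟩
  | succ M ih =>
    refine ⟨ha.1.add hb.1, fun x => (norm_add_le _ _).trans (add_le_add (ha.2.1 x) (hb.2.1 x)),
      fun i => ?_⟩
    have e : partialDeriv i (fun x => a x + b x) =
        fun x => partialDeriv i a x + partialDeriv i b x := by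
      ext x
      simp only [partialDeriv]
      rw [fderiv_fun_add (ha.1 x) (hb.1 x)]; rfl
    rw [e, add_mul]
    exact ih (ha.2.2 i) (hb.2.2 i)

lemma mul (ha : DerivBound M a A R) (hb : DerivBound M b B R) :
    DerivBound M (fun x => a x * b x) (2 ^ M * (A * B)) R := by
  induction M generalizing a b A B with
  | zero =>
    refine ⟨ha.1.mul hb.1, fun x => ?_⟩
    rw [norm_mul, pow_zero, one_mul]
    exact mul_le_mul (ha.2 x) (hb.2 x) (norm_nonneg _) ha.nonneg
  | succ M ih =>
    have hA := ha.nonneg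
    have hB := hb.nonneg
    refine ⟨ha.1.mul hb.1, fun x => ?_, fun i => ?_⟩
    · rw [norm_mul]
      exact (mul_le_mul (ha.2.1 x) (hb.2.1 x) (norm_nonneg _) hA).trans
        (le_mul_of_one_le_left (by positivity) (one_le_pow₀ one_le_two))
    · have e : partialDeriv i (fun x => a x * b x) =
          fun x => a x * partialDeriv i b x + b x * partialDeriv i a x := by
        ext x
        simp only [partialDeriv]
        rw [fderiv_fun_mul (ha.1 x) (hb.1 x)]; simp
      have e2 : 2 ^ (M + 1) * (A * B) * R = 2 ^ M * (A * (B * R)) + 2 ^ M * (B * (A * R)) := by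
        ring
      rw [e, e2]
      exact (ih ha.of_succ (hb.2.2 i)).add (ih hb.of_succ (ha.2.2 i))

lemma star (ha : DerivBound M a A R) : DerivBound M (fun x => star (a x)) A R := by
  induction M generalizing a A with
  | zero => exact ⟨ha.1.star, fun x => by simpa using ha.2 x⟩
  | succ M ih =>
    refine ⟨ha.1.star, fun x => by simpa using ha.2.1 x, fun i => ?_⟩
    have e : partialDeriv i (fun x => Star.star (a x)) =
        fun x => Star.star (partialDeriv i a x) := by
      ext x
      simp only [partialDeriv]
      rw [fderiv_star]; rfl
    rw [e]
    exact ih (ha.2.2 i)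

lemma of_multiDeriv {N : ℕ} {g : Rn n → ℂ} (hg : ContDiff ℝ (N : WithTop ℕ∞) g)
    (h : ∀ ν : MIdx n, ν.len ≤ N → ∀ x, ‖multiDeriv ν g x‖ ≤ A * R ^ ν.len) :
    DerivBound N g A R := by
  have key : ∀ M : ℕ, ∀ ν : MIdx n, M + ν.len ≤ N →
      DerivBound M (multiDeriv ν g) (A * R ^ ν.len) R := by
    intro M
    induction M with
    | zero =>
      intro ν hν
      exact ⟨(contDiff_multiDeriv (m := 0) ν (hg.of_le (by exact_mod_cast hν))).continuous,
        h ν (by omega)⟩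
    | succ M ih =>
      intro ν hν
      refine ⟨(contDiff_multiDeriv (m := 1) ν (hg.of_le ?_)).differentiable (by norm_num),
        h ν (by omega), fun i => ?_⟩
      · exact_mod_cast (by omega : 1 + ν.len ≤ N)
      · rw [partialDeriv_multiDeriv i ν (hg.of_le (by exact_mod_cast (by omega : ν.len + 1 ≤ N)))]
        have := ih (ν + Pi.single i 1) (by rw [len_add_single]; omega)
        rwa [len_add_single, pow_succ, ← mul_assoc] at this
  have h0 : MIdx.len (0 : MIdx n) = 0 := by simp [MIdx.len]
  have := key N 0 (by rw [h0]; omega)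
  rwa [multiDeriv_zero, h0, pow_zero, mul_one] at this

end DerivBound

/-! ### Almost orthogonality by integration by parts -/

lemma integrable_mul_hermiteE_mul {a : Rn n → ℂ} {A : ℝ} (hc : Continuous a)
    (hA : ∀ x, ‖a x‖ ≤ A) (ξ η : MIdx n) :
    Integrable fun x => a x * ((hermiteE ξ x * hermiteE η x : ℝ) : ℂ) :=
  ((integrable_hermiteE_mul ξ η).ofReal).bdd_mul hc.aestronglyMeasurable
    (Eventually.of_forall hA)

/-- Integration by parts against the Wronskian of `hermiteE ξ` and `hermiteE η` in the `i`-th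
variable, whose derivative is `2 (ξᵢ - ηᵢ) * hermiteE ξ * hermiteE η`. -/
lemma integral_mul_hermiteE_mul_ibp {a : Rn n → ℂ} {A R : ℝ} (ha : DerivBound 1 a A R) (i : Fin n)
    (ξ η : MIdx n) :
    2 * ((η i : ℂ) - ξ i) * ∫ x, a x * ((hermiteE ξ x * hermiteE η x : ℝ) : ℂ) =
      (∫ x, partialDeriv i a x * ((hermiteE (ξ + Pi.single i 1) x * hermiteE η x : ℝ) : ℂ)) -
        ∫ x, partialDeriv i a x * ((hermiteE ξ x * hermiteE (η + Pi.single i 1) x : ℝ) : ℂ) := by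
  set e : MIdx n := Pi.single i 1 with he
  set v : Rn n := EuclideanSpace.single i 1 with hv
  let W : Rn n → ℝ := fun x => hermiteE (ξ + e) x * hermiteE η x - hermiteE ξ x * hermiteE (η + e) x
  have hW : ∀ x, HasLineDerivAt ℝ (fun x => (W x : ℂ))
      ((2 * ((ξ i : ℝ) - η i) * (hermiteE ξ x * hermiteE η x) : ℝ) : ℂ) x v := by
    intro x
    have h1 := hasLineDerivAt_hermiteE (ξ + e) i x
    have h2 := hasLineDerivAt_hermiteE η i x
    have h3 := hasLineDerivAt_hermiteE ξ i x
    have h4 := hasLineDerivAt_hermiteE (η + e) i x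
    unfold HasLineDerivAt at h1 h2 h3 h4 ⊢
    refine HasDerivAt.ofReal_comp ((((h1.mul h2).sub (h3.mul h4))).congr_deriv ?_)
    have l1 := hermiteE_ladder (ξ + e) i x
    have l2 := hermiteE_ladder (η + e) i x
    simp only [he, add_tsub_cancel_right, Pi.add_apply, Pi.single_eq_same, Nat.cast_add,
      Nat.cast_one] at l1 l2
    simp only [zero_smul, add_zero, ← he] at l1 l2 ⊢
    linear_combination 2 * hermiteE η x * l1 - 2 * hermiteE ξ x * l2
  have ha' : ∀ x, HasLineDerivAt ℝ a (partialDeriv i a x) x v := fun x =>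
    (ha.1 x).hasFDerivAt.hasLineDerivAt v
  have hd := ha.2.2 i
  have i1 := integrable_mul_hermiteE_mul hd.continuous hd.norm_le (ξ + e) η
  have i2 := integrable_mul_hermiteE_mul hd.continuous hd.norm_le ξ (η + e)
  have e1 : ∀ (g : Rn n → ℂ) (x : Rn n), g x * (W x : ℂ) =
      g x * ((hermiteE (ξ + e) x * hermiteE η x : ℝ) : ℂ) -
        g x * ((hermiteE ξ x * hermiteE (η + e) x : ℝ) : ℂ) := fun g x => by
    simp only [W]; push_cast; ring
  have e2 : ∀ x, a x * ((2 * ((ξ i : ℝ) - η i) * (hermiteE ξ x * hermiteE η x) : ℝ) : ℂ) =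
      2 * ((ξ i : ℂ) - η i) * (a x * ((hermiteE ξ x * hermiteE η x : ℝ) : ℂ)) := fun x => by
    push_cast; ring
  have key := integral_bilinear_hasLineDerivAt_right_eq_neg_left_of_integrable (μ := volume)
    (B := ContinuousLinearMap.mul ℝ ℂ) (f := a) (f' := partialDeriv i a)
    (g := fun x => (W x : ℂ))
    (g' := fun x => ((2 * ((ξ i : ℝ) - η i) * (hermiteE ξ x * hermiteE η x) : ℝ) : ℂ)) (v := v)
    (by
      simp only [ContinuousLinearMap.mul_apply', e1]
      exact i1.sub i2)
    (by
      simp only [ContinuousLinearMap.mul_apply', e2]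
      exact (integrable_mul_hermiteE_mul ha.continuous ha.norm_le ξ η).const_mul _)
    (by
      simp only [ContinuousLinearMap.mul_apply', e1]
      exact (integrable_mul_hermiteE_mul ha.continuous ha.norm_le (ξ + e) η).sub
        (integrable_mul_hermiteE_mul ha.continuous ha.norm_le ξ (η + e)))
    (fun x _ => ha' x) (fun x _ => hW x)
  simp only [ContinuousLinearMap.mul_apply', e1, e2] at key
  rw [integral_const_mul, integral_sub i1 i2] at key
  linear_combination -key

lemma norm_integral_mul_hermiteE_le {a : Rn n → ℂ} {A : ℝ} (hA : ∀ x, ‖a x‖ ≤ A) (ξ η : MIdx n) :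
    ‖∫ x, a x * ((hermiteE ξ x * hermiteE η x : ℝ) : ℂ)‖ ≤
      A * (Real.sqrt (hermiteNormSq ξ) * Real.sqrt (hermiteNormSq η)) := by
  have hA0 : 0 ≤ A := (norm_nonneg _).trans (hA 0)
  set s := Real.sqrt (hermiteNormSq ξ) with hs
  set t := Real.sqrt (hermiteNormSq η) with ht
  have hs0 : 0 < s := Real.sqrt_pos.2 (hermiteNormSq_pos ξ)
  have ht0 : 0 < t := Real.sqrt_pos.2 (hermiteNormSq_pos η)
  have hs2 : hermiteNormSq ξ = s * s := (Real.mul_self_sqrt (hermiteNormSq_pos ξ).le).symm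
  have ht2 : hermiteNormSq η = t * t := (Real.mul_self_sqrt (hermiteNormSq_pos η).le).symm
  have i1 := (integrable_hermiteE_mul ξ ξ).const_mul (A / 2 * (t / s))
  have i2 := (integrable_hermiteE_mul η η).const_mul (A / 2 * (s / t))
  refine (norm_integral_le_of_norm_le (i1.add i2) (Eventually.of_forall fun x => ?_)).trans_eq ?_
  · rw [norm_mul, Complex.norm_real, Real.norm_eq_abs]
    refine (mul_le_mul_of_nonneg_right (hA x) (abs_nonneg _)).trans ?_
    simp only [Pi.add_apply]
    rw [mul_assoc (A / 2), mul_assoc (A / 2), ← mul_add, abs_mul]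
    have h : 0 ≤ A / 2 * ((|hermiteE ξ x| * t - |hermiteE η x| * s) ^ 2 / (s * t)) := by positivity
    have h1 := abs_mul_abs_self (hermiteE ξ x)
    have h2 := abs_mul_abs_self (hermiteE η x)
    have h3 : A / 2 * (t / s * (hermiteE ξ x * hermiteE ξ x) +
        s / t * (hermiteE η x * hermiteE η x)) - A * (|hermiteE ξ x| * |hermiteE η x|) =
        A / 2 * ((|hermiteE ξ x| * t - |hermiteE η x| * s) ^ 2 / (s * t)) := by
      rw [← h1, ← h2]; field_simp; ring
    linarith
  · simp only [Pi.add_apply]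
    rw [integral_add i1 i2, integral_const_mul, integral_const_mul, integral_hermiteE_mul,
      integral_hermiteE_mul, if_pos rfl, if_pos rfl, hs2, ht2]
    field_simp; ring

/-- `M` integrations by parts, each divided by `|η| - |ξ|`. A step moves `|ξ|` or `|η|` up by one,
so that the room `M` in the hypotheses keeps the gap above `G` and the lengths below `L`. -/
lemma norm_integral_mul_hermiteE_decay (M : ℕ) : ∀ {a : Rn n → ℂ} {A R G L : ℝ} {ξ η : MIdx n},
    DerivBound M a A R → 0 ≤ R → 0 < G → (ξ.len : ℝ) + M ≤ L → (η.len : ℝ) + M ≤ L →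
    (ξ.len : ℝ) + M + G ≤ η.len →
    ‖∫ x, a x * ((hermiteE ξ x * hermiteE η x : ℝ) : ℂ)‖ ≤
      A * (n * R * Real.sqrt (2 * L) / G) ^ M *
        (Real.sqrt (hermiteNormSq ξ) * Real.sqrt (hermiteNormSq η)) := by
  induction M with
  | zero =>
    intro a A R G L ξ η ha _ _ _ _ _
    simpa using norm_integral_mul_hermiteE_le ha.norm_le ξ η
  | succ M ih =>
    intro a A R G L ξ η ha hR hG hξ hη hgap
    push_cast at hξ hη hgap
    have hA := ha.nonneg
    have ha1 : DerivBound 1 a A R := by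
      refine ⟨ha.1, ha.2.1, fun i => ⟨(ha.2.2 i).continuous, (ha.2.2 i).norm_le⟩⟩
    set s := Real.sqrt (hermiteNormSq ξ) with hs
    set t := Real.sqrt (hermiteNormSq η) with ht
    have hs0 : 0 ≤ s := Real.sqrt_nonneg _
    have ht0 : 0 ≤ t := Real.sqrt_nonneg _
    set X := n * R * Real.sqrt (2 * L) / G with hX
    have hX0 : 0 ≤ X := by positivity
    set I := ∫ x, a x * ((hermiteE ξ x * hermiteE η x : ℝ) : ℂ) with hI
    have hstep : ∀ (ζ : MIdx n) (i : Fin n), (ζ.len : ℝ) + (M + 1) ≤ L →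
        Real.sqrt (hermiteNormSq (ζ + Pi.single i 1)) ≤
          Real.sqrt (2 * L) * Real.sqrt (hermiteNormSq ζ) := fun ζ i h => by
      rw [hermiteNormSq_add_single, ← Real.sqrt_mul' _ (hermiteNormSq_pos ζ).le]
      refine Real.sqrt_le_sqrt (mul_le_mul_of_nonneg_right ?_ (hermiteNormSq_pos ζ).le)
      have h1 : (ζ i : ℝ) ≤ ζ.len := by exact_mod_cast le_len ζ i
      have h2 : (0 : ℝ) ≤ M := Nat.cast_nonneg _
      linarith
    have hsum : (2 * ((η.len : ℂ) - ξ.len)) * I = ∑ i,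
        ((∫ x, partialDeriv i a x * ((hermiteE (ξ + Pi.single i 1) x * hermiteE η x : ℝ) : ℂ)) -
        ∫ x, partialDeriv i a x * ((hermiteE ξ x * hermiteE (η + Pi.single i 1) x : ℝ) : ℂ)) := by
      simp_rw [← integral_mul_hermiteE_mul_ibp ha1]
      rw [← Finset.sum_mul, ← Finset.mul_sum, Finset.sum_sub_distrib, ← hI]
      simp only [MIdx.len, Nat.cast_sum]
    have hterm : ∀ i,
        ‖(∫ x, partialDeriv i a x * ((hermiteE (ξ + Pi.single i 1) x * hermiteE η x : ℝ) : ℂ)) -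
        ∫ x, partialDeriv i a x * ((hermiteE ξ x * hermiteE (η + Pi.single i 1) x : ℝ) : ℂ)‖ ≤
        2 * (A * R * X ^ M * (Real.sqrt (2 * L) * (s * t))) := fun i => by
      have b1 := ih (ξ := ξ + Pi.single i 1) (η := η) (L := L) (G := G) (ha.2.2 i) hR hG
        (by rw [len_add_single]; push_cast; linarith) (by linarith)
        (by rw [len_add_single]; push_cast; linarith)
      have b2 := ih (ξ := ξ) (η := η + Pi.single i 1) (L := L) (G := G) (ha.2.2 i) hR hG
        (by linarith) (by rw [len_add_single]; push_cast; linarith)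
        (by rw [len_add_single]; push_cast; linarith)
      refine (norm_sub_le _ _).trans ((add_le_add b1 b2).trans ?_)
      rw [two_mul (A * R * X ^ M * (Real.sqrt (2 * L) * (s * t)))]
      refine add_le_add ?_ ?_
      · refine mul_le_mul_of_nonneg_left ?_ (by positivity)
        rw [← mul_assoc]
        exact mul_le_mul_of_nonneg_right (hstep ξ i hξ) ht0
      · refine mul_le_mul_of_nonneg_left ?_ (by positivity)
        rw [mul_left_comm]
        exact mul_le_mul_of_nonneg_left (hstep η i hη) hs0
    have hle : 2 * G * ‖I‖ ≤ n * (2 * (A * R * X ^ M * (Real.sqrt (2 * L) * (s * t)))) := by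
      have h1 : ‖(2 * ((η.len : ℂ) - ξ.len)) * I‖ ≤
          n * (2 * (A * R * X ^ M * (Real.sqrt (2 * L) * (s * t)))) := by
        rw [hsum]
        refine (norm_sum_le_of_le _ fun i _ => hterm i).trans_eq ?_
        simp
      refine le_trans ?_ h1
      rw [norm_mul]
      refine mul_le_mul_of_nonneg_right ?_ (norm_nonneg _)
      have h2 : (2 * ((η.len : ℂ) - ξ.len)) = ((2 * ((η.len : ℝ) - ξ.len) : ℝ) : ℂ) := by
        push_cast; ring
      rw [h2, Complex.norm_real, Real.norm_eq_abs]
      have h3 : (0 : ℝ) ≤ M := Nat.cast_nonneg _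
      refine le_trans ?_ (le_abs_self _)
      linarith
    have hfin : A * X ^ (M + 1) * (s * t) =
        n * (2 * (A * R * X ^ M * (Real.sqrt (2 * L) * (s * t)))) / (2 * G) := by
      have hXG : X * G = n * R * Real.sqrt (2 * L) := div_mul_cancel₀ _ hG.ne'
      rw [eq_div_iff (by positivity), pow_succ]
      linear_combination 2 * A * X ^ M * (s * t) * hXG
    rw [hfin, le_div_iff₀ (by positivity)]
    linarith

/-! ### Differences of symbols and dyadic cutoffs -/

/-- `DiffBound i K s g A`: the differences of `g` of order `l ≤ K` in the `i`-th variable are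
bounded by `A ⟨ξ⟩^{-s-l}`. -/
def DiffBound (i : Fin n) (K s : ℕ) (g : MIdx n → ℂ) (A : ℝ) : Prop :=
  ∀ l ≤ K, ∀ ξ, ‖(partialDiff i)^[l] g ξ‖ ≤ A / (1 + (ξ.len : ℝ)) ^ (s + l)

namespace DiffBound

variable {i : Fin n} {K s t : ℕ} {f g : MIdx n → ℂ} {A B : ℝ}

lemma succ_iff : DiffBound i (K + 1) s g A ↔
    (∀ ξ, ‖g ξ‖ ≤ A / (1 + (ξ.len : ℝ)) ^ s) ∧ DiffBound i K (s + 1) (partialDiff i g) A := by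
  constructor
  · refine fun h => ⟨fun ξ => by simpa using h 0 (Nat.zero_le _) ξ, fun l hl ξ => ?_⟩
    have := h (l + 1) (by omega) ξ
    rwa [Function.iterate_succ_apply, ← add_assoc, add_right_comm] at this
  · rintro ⟨h0, h⟩ l hl ξ
    rcases l with _ | l
    · simpa using h0 ξ
    · have := h l (by omega) ξ
      rwa [Function.iterate_succ_apply, ← add_assoc, add_right_comm]

lemma zero_iff : DiffBound i 0 s g A ↔ ∀ ξ, ‖g ξ‖ ≤ A / (1 + (ξ.len : ℝ)) ^ s :=
  ⟨fun h ξ => by simpa using h 0 le_rfl ξ, fun h l hl ξ => by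
    obtain rfl : l = 0 := by omega
    simpa using h ξ⟩

lemma norm_le (h : DiffBound i K s g A) (ξ : MIdx n) : ‖g ξ‖ ≤ A / (1 + (ξ.len : ℝ)) ^ s := by
  simpa using h 0 (Nat.zero_le _) ξ

lemma nonneg (h : DiffBound i K s g A) : 0 ≤ A := by
  have := (norm_nonneg _).trans (h.norm_le 0)
  simpa [MIdx.len] using this

lemma of_succ (h : DiffBound i (K + 1) s g A) : DiffBound i K s g A :=
  fun l hl => h l (by omega)

lemma shift (h : DiffBound i K s g A) : DiffBound i K s (fun ξ => g (ξ + Pi.single i 1)) A := by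
  have hA := h.nonneg
  intro l hl ξ
  have e : ∀ (l : ℕ) (g : MIdx n → ℂ) (ξ : MIdx n),
      (partialDiff i)^[l] (fun ξ => g (ξ + Pi.single i 1)) ξ =
        (partialDiff i)^[l] g (ξ + Pi.single i 1) := by
    intro l
    induction l with
    | zero => intro g ξ; rfl
    | succ l ih => intro g ξ; exact ih (partialDiff i g) ξ
  rw [e]
  refine (h l hl _).trans ?_
  rw [len_add_single]
  push_cast
  gcongr
  linarith

lemma add (hf : DiffBound i K s f A) (hg : DiffBound i K s g B) :
    DiffBound i K s (fun ξ => f ξ + g ξ) (A + B) := by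
  induction K generalizing s f g with
  | zero =>
    refine zero_iff.2 fun ξ => ?_
    rw [add_div]
    exact (norm_add_le _ _).trans (add_le_add (hf.norm_le ξ) (hg.norm_le ξ))
  | succ K ih =>
    refine succ_iff.2 ⟨fun ξ => ?_, ?_⟩
    · rw [add_div]
      exact (norm_add_le _ _).trans (add_le_add (hf.norm_le ξ) (hg.norm_le ξ))
    · have e : partialDiff i (fun ξ => f ξ + g ξ) =
          fun ξ => partialDiff i f ξ + partialDiff i g ξ := by
        ext ξ; simp only [partialDiff]; ring
      rw [e]
      exact ih (succ_iff.1 hf).2 (succ_iff.1 hg).2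

lemma norm_mul_le (hf : DiffBound i K s f A) (hg : DiffBound i K t g B) (ξ : MIdx n) :
    ‖f ξ * g ξ‖ ≤ A * B / (1 + (ξ.len : ℝ)) ^ (s + t) := by
  rw [norm_mul, pow_add, ← div_mul_div_comm]
  exact mul_le_mul (hf.norm_le ξ) (hg.norm_le ξ) (norm_nonneg _)
    ((norm_nonneg _).trans (hf.norm_le ξ))

lemma mul (hf : DiffBound i K s f A) (hg : DiffBound i K t g B) :
    DiffBound i K (s + t) (fun ξ => f ξ * g ξ) (2 ^ K * (A * B)) := by
  induction K generalizing s t f g with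
  | zero =>
    refine zero_iff.2 fun ξ => ?_
    rw [pow_zero, one_mul]
    exact hf.norm_mul_le hg ξ
  | succ K ih =>
    have hA := hf.nonneg
    have hB := hg.nonneg
    refine succ_iff.2 ⟨fun ξ => (hf.norm_mul_le hg ξ).trans ?_, ?_⟩
    · have : (1 : ℝ) ≤ 2 ^ (K + 1) := one_le_pow₀ one_le_two
      exact div_le_div_of_nonneg_right (le_mul_of_one_le_left (by positivity) this) (by positivity)
    · have e : partialDiff i (fun ξ => f ξ * g ξ) = fun ξ =>
          partialDiff i f ξ * g (ξ + Pi.single i 1) + f ξ * partialDiff i g ξ := by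
        ext ξ; simp only [partialDiff]; ring
      rw [e, pow_succ, mul_assoc, two_mul, mul_add]
      refine DiffBound.add ?_ ?_
      · have := ih (succ_iff.1 hf).2 hg.of_succ.shift
        rwa [add_right_comm] at this
      · have := ih hf.of_succ (succ_iff.1 hg).2
        rwa [← add_assoc] at this

end DiffBound

lemma iterate_partialDiff_eq_zero (i : Fin n) (l : ℕ) : ∀ {g : MIdx n → ℂ} {ξ : MIdx n},
    (∀ m ≤ l, g (ξ + Pi.single i m) = 0) → (partialDiff i)^[l] g ξ = 0 := by
  induction l with
  | zero => intro g ξ h; simpa using h 0 le_rfl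
  | succ l ih =>
    intro g ξ h
    rw [Function.iterate_succ_apply]
    refine ih fun m hm => ?_
    rw [partialDiff, add_assoc, ← Pi.single_add, h m (by omega), h (m + 1) (by omega), sub_zero]

/-- A smooth function on `ℝ` that is `1` on `[-1, 1]` and vanishes off `(-2, 2)`. -/
def cutoffBump : ContDiffBump (0 : ℝ) := ⟨1, 2, one_pos, one_lt_two⟩

/-- The Littlewood–Paley function `ψ(t) - ψ(2t)` with `ψ = cutoffBump`. -/
def dyadicBump (t : ℝ) : ℝ := cutoffBump t - cutoffBump (2 * t)

/-- The cutoff to multi-indices with `⟨ξ⟩ ∼ 2^j`. -/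
def dyadicCutoff (j : ℕ) (ξ : MIdx n) : ℝ := dyadicBump ((1 + (ξ.len : ℝ)) / 2 ^ j)

lemma cutoffBump_eq_one {t : ℝ} (h0 : 0 ≤ t) (h1 : t ≤ 1) : cutoffBump t = 1 :=
  cutoffBump.one_of_mem_closedBall (by simpa [cutoffBump, abs_of_nonneg h0] using h1)

lemma cutoffBump_eq_zero {t : ℝ} (h : 2 ≤ t) : cutoffBump t = 0 :=
  cutoffBump.zero_of_le_dist (by
    simpa [cutoffBump, abs_of_nonneg (zero_le_two.trans h)] using h)

lemma contDiff_dyadicBump (m : ℕ) : ContDiff ℝ (m : WithTop ℕ∞) dyadicBump := by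
  have h : ContDiff ℝ (m : WithTop ℕ∞) cutoffBump := cutoffBump.contDiff
  exact h.sub (h.comp (by fun_prop))

lemma hasCompactSupport_dyadicBump : HasCompactSupport dyadicBump :=
  cutoffBump.hasCompactSupport.sub
    (cutoffBump.hasCompactSupport.comp_smul (c := (2 : ℝ)) two_ne_zero)

lemma lt_two_of_dyadicBump_ne_zero {t : ℝ} (h : dyadicBump t ≠ 0) : t < 2 := by
  by_contra! h2
  exact h (by rw [dyadicBump, cutoffBump_eq_zero h2, cutoffBump_eq_zero (by linarith), sub_zero])

lemma half_lt_of_dyadicBump_ne_zero {t : ℝ} (h0 : 0 ≤ t) (h : dyadicBump t ≠ 0) : 1 / 2 < t := by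
  by_contra! h2
  exact h (by rw [dyadicBump, cutoffBump_eq_one h0 (by linarith),
    cutoffBump_eq_one (by linarith) (by linarith), sub_self])

lemma exists_iteratedDeriv_dyadicBump_le (l : ℕ) :
    ∃ C : ℝ, ∀ t, ‖iteratedDeriv l dyadicBump t‖ ≤ C := by
  obtain ⟨C, hC⟩ := ((contDiff_dyadicBump l).continuous_iteratedFDeriv
    le_rfl).bounded_above_of_compact_support
    (hasCompactSupport_dyadicBump.iteratedFDeriv (𝕜 := ℝ) l)
  exact ⟨C, fun t => by rw [← norm_iteratedFDeriv_eq_norm_iteratedDeriv]; exact hC t⟩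

/-- Forward differences along `ξᵢ` of a function of `⟨ξ⟩` are bounded by derivatives. -/
lemma norm_iterate_partialDiff_le (i : Fin n) {h : ℝ} (hh : 0 ≤ h) (l : ℕ) :
    ∀ {f : ℝ → ℝ} {C : ℝ}, ContDiff ℝ (l : WithTop ℕ∞) f → (∀ t, ‖iteratedDeriv l f t‖ ≤ C) →
      ∀ ξ : MIdx n, ‖(partialDiff i)^[l] (fun ξ => (f ((1 + (ξ.len : ℝ)) * h) : ℂ)) ξ‖ ≤
        C * h ^ l := by
  induction l with
  | zero =>
    intro f C _ hC ξ
    simpa using hC _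
  | succ l ih =>
    intro f C hf hC ξ
    have hf' : ContDiff ℝ (l : WithTop ℕ∞) f := hf.of_le (by exact_mod_cast Nat.le_succ l)
    have hs : ContDiff ℝ (l : WithTop ℕ∞) (fun t => f (t + h)) :=
      hf'.comp (contDiff_id.add contDiff_const)
    have e : partialDiff i (fun ξ : MIdx n => (f ((1 + (ξ.len : ℝ)) * h) : ℂ)) =
        fun ξ => ((fun t => f (t + h) - f t) ((1 + (ξ.len : ℝ)) * h) : ℂ) := by
      ext ξ
      simp only [partialDiff, len_add_single]
      push_cast
      congr 3
      ring_nf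
    rw [Function.iterate_succ_apply, e]
    have key := ih (f := fun t => f (t + h) - f t) (C := C * h) (hs.sub hf') (fun t => by
      have e2 : iteratedDeriv l (fun t => f (t + h) - f t) t =
          iteratedDeriv l f (t + h) - iteratedDeriv l f t := by
        rw [iteratedDeriv_fun_sub hs.contDiffAt hf'.contDiffAt]
        rw [iteratedDeriv_comp_add_const]
      rw [e2]
      have hd : Differentiable ℝ (iteratedDeriv l f) :=
        hf.differentiable_iteratedDeriv l (by exact_mod_cast Nat.lt_succ_self l)
      have := Convex.norm_image_sub_le_of_norm_deriv_le (𝕜 := ℝ) (f := iteratedDeriv l f)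
        (s := Set.univ) (x := t) (y := t + h) (C := C) (fun x _ => hd x)
        (fun x _ => by rw [← iteratedDeriv_succ]; exact hC x) convex_univ trivial trivial
      simpa [abs_of_nonneg hh] using this) ξ
    refine (le_of_eq ?_).trans (key.trans_eq (by ring))
    simp

lemma diffBound_dyadicCutoff (n K : ℕ) : ∃ C : ℝ, ∀ (i : Fin n) (j : ℕ),
    DiffBound i K 0 (fun ξ => (dyadicCutoff j ξ : ℂ)) C := by
  choose D hD using exists_iteratedDeriv_dyadicBump_le
  have hD0 : ∀ l, 0 ≤ D l := fun l => (norm_nonneg _).trans (hD l 0)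
  refine ⟨∑ l ∈ Finset.range (K + 1), D l * 2 ^ l, fun i j l hl ξ => ?_⟩
  have hle : D l * 2 ^ l ≤ ∑ l ∈ Finset.range (K + 1), D l * 2 ^ l :=
    Finset.single_le_sum (f := fun l => D l * 2 ^ l)
      (fun l _ => mul_nonneg (hD0 l) (by positivity)) (Finset.mem_range.2 (by omega))
  have hpos : (0 : ℝ) < 1 + ξ.len := by positivity
  rw [zero_add, le_div_iff₀ (by positivity)]
  refine le_trans ?_ hle
  by_cases h2 : (2 : ℝ) ≤ (1 + ξ.len) / 2 ^ j
  · rw [iterate_partialDiff_eq_zero, norm_zero, zero_mul]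
    · exact mul_nonneg (hD0 l) (by positivity)
    · intro m _
      have : (2 : ℝ) ≤ (1 + (MIdx.len (ξ + Pi.single i m) : ℝ)) / 2 ^ j := by
        refine h2.trans ?_
        gcongr
        exact Finset.sum_le_sum fun k _ => by simp
      rw [dyadicCutoff]
      by_contra h
      exact absurd (lt_two_of_dyadicBump_ne_zero fun h0 => h (by rw [h0]; simp)) (not_lt.2 this)
  · have h1 := norm_iterate_partialDiff_le i (h := (2 ^ j)⁻¹) (by positivity) l
      (contDiff_dyadicBump l) (hD l) ξ
    simp only [dyadicCutoff, div_eq_mul_inv]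
    rw [not_le, div_eq_mul_inv] at h2
    calc _ ≤ D l * ((2 ^ j)⁻¹) ^ l * (1 + (ξ.len : ℝ)) ^ l := by gcongr
      _ = D l * ((1 + (ξ.len : ℝ)) * (2 ^ j)⁻¹) ^ l := by rw [mul_pow]; ring
      _ ≤ D l * 2 ^ l := by
          have := hD0 l
          gcongr

lemma sum_dyadicCutoff (J : ℕ) (ξ : MIdx n) (h : 1 + (ξ.len : ℝ) ≤ 2 ^ J) :
    ∑ j ∈ Finset.range (J + 1), dyadicCutoff j ξ = 1 := by
  have key : ∀ J : ℕ, ∑ j ∈ Finset.range (J + 1), dyadicCutoff j ξ =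
      cutoffBump ((1 + (ξ.len : ℝ)) / 2 ^ J) := by
    intro J
    induction J with
    | zero =>
      have h2 : (2 : ℝ) ≤ 2 * (1 + ξ.len) := by
        have : (0 : ℝ) ≤ ξ.len := Nat.cast_nonneg _
        linarith
      simp [dyadicCutoff, dyadicBump, cutoffBump_eq_zero h2]
    | succ J ih =>
      have e : 2 * ((1 + (ξ.len : ℝ)) / 2 ^ (J + 1)) = (1 + (ξ.len : ℝ)) / 2 ^ J := by
        field_simp; ring
      rw [Finset.sum_range_succ, ih, dyadicCutoff, dyadicBump, e]
      ring
  rw [key]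
  exact cutoffBump_eq_one (by positivity) (by rw [div_le_one (by positivity)]; exact h)

lemma lt_of_dyadicCutoff_ne_zero {j : ℕ} {ξ : MIdx n} (h : dyadicCutoff j ξ ≠ 0) :
    (2 : ℝ) ^ j < 2 * (1 + ξ.len) ∧ 1 + (ξ.len : ℝ) < 2 * 2 ^ j := by
  have h1 := lt_two_of_dyadicBump_ne_zero h
  have h2 := half_lt_of_dyadicBump_ne_zero (by positivity) h
  rw [div_lt_iff₀ (by positivity)] at h1
  rw [lt_div_iff₀ (by positivity)] at h2
  exact ⟨by linarith, h1⟩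

/-- The bounds on the pieces `χ_j σ` of a symbol, on square sums over `⟨ξ⟩ ∼ 2^j`. -/
theorem exists_dyadic_block_bound {K : ℕ} (hn : 1 ≤ n) (hK : n < 2 * K) {σ : Rn n → MIdx n → ℂ}
    {A : ℝ} (hσ : ∀ x i, DiffBound i K 0 (σ x) A) : ∃ C : ℝ, 0 ≤ C ∧
      ∀ (j : ℕ) (s : Finset (MIdx n)) (c : MIdx n → ℂ),
        ∫⁻ x, ‖∑ ξ ∈ s, (dyadicCutoff j ξ : ℂ) * c ξ * (σ x ξ * (hermiteFun ξ x : ℂ))‖ₑ ^ 2 ≤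
          ENNReal.ofReal (C * ∑ ξ ∈ s with dyadicCutoff j ξ ≠ 0, ‖c ξ‖ ^ 2) := by
  obtain ⟨C, hC, hblock⟩ := exists_block_bound hn hK
  obtain ⟨D, hD⟩ := diffBound_dyadicCutoff n K
  have hA : 0 ≤ A := (hσ 0 ⟨0, hn⟩).nonneg
  have hD0 : 0 ≤ D := (hD ⟨0, hn⟩ 0).nonneg
  set A' : ℝ := 2 ^ K * (D * A) * (4 * K + 5) ^ K with hA'
  refine ⟨C * A' ^ 2, by positivity, fun j s c => ?_⟩
  have hbox : ∀ ξ : MIdx n, ξ ∉ box n (2 ^ (j + 1)) → dyadicCutoff j ξ = 0 := by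
    intro ξ hξ
    by_contra h
    refine hξ (mem_box.2 fun i => ?_)
    have h1 := (lt_of_dyadicCutoff_ne_zero h).2
    have h2 : (ξ i : ℝ) ≤ ξ.len := by exact_mod_cast le_len ξ i
    have : (ξ i : ℝ) ≤ (2 ^ (j + 1) : ℕ) := by
      push_cast
      rw [pow_succ]; linarith
    exact_mod_cast this
  have key := hblock (2 ^ (j + 1)) (fun x ξ => (dyadicCutoff j ξ : ℂ) * σ x ξ) A'
    (fun x ξ hξ => by simp [hbox ξ hξ])
    (fun x i l hl ξ => by
      -- A difference of order `l ≤ K` reaches at most `K` steps beyond `ξ`, so where it does not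
      -- vanish, `2^{j+1} + 1 ≤ (4K + 5) ⟨ξ⟩`.
      by_cases hz : ∀ m ≤ l, dyadicCutoff j (ξ + Pi.single i m) = 0
      · rw [iterate_partialDiff_eq_zero i l fun m hm => by simp [hz m hm], norm_zero]
        positivity
      · push Not at hz
        obtain ⟨m, hm, hne⟩ := hz
        have h1 := (lt_of_dyadicCutoff_ne_zero hne).1
        have h2 : MIdx.len (ξ + Pi.single i m) = ξ.len + m := by
          simp [MIdx.len, Finset.sum_add_distrib]
        have h3 : (m : ℝ) ≤ K := by exact_mod_cast hm.trans hl
        rw [h2] at h1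
        push_cast at h1 ⊢
        have hpos : (0 : ℝ) < 1 + ξ.len := by positivity
        have h4 : (2 : ℝ) ^ (j + 1) + 1 ≤ (4 * K + 5) * (1 + ξ.len) := by
          rw [pow_succ]
          have : (0 : ℝ) ≤ K * ξ.len := by positivity
          have : (0 : ℝ) ≤ ξ.len := by positivity
          nlinarith
        have h5 := ((hD i j).mul (hσ x i)) l hl ξ
        refine h5.trans ?_
        rw [zero_add, zero_add, div_le_div_iff₀ (by positivity) (by positivity), hA']
        calc 2 ^ K * (D * A) * ((2 : ℝ) ^ (j + 1) + 1) ^ l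
            ≤ 2 ^ K * (D * A) * ((4 * K + 5) * (1 + ξ.len)) ^ l := by gcongr
          _ = 2 ^ K * (D * A) * (4 * K + 5) ^ l * (1 + ξ.len) ^ l := by rw [mul_pow]; ring
          _ ≤ _ := by
            gcongr
            have : (0 : ℝ) ≤ K := Nat.cast_nonneg _
            linarith)
    (fun ξ => if ξ ∈ s ∧ dyadicCutoff j ξ ≠ 0 then c ξ else 0)
  have hsub : (s.filter fun ξ => dyadicCutoff j ξ ≠ 0) ⊆ box n (2 ^ (j + 1)) := fun ξ hξ => by
    by_contra h
    exact (Finset.mem_filter.1 hξ).2 (hbox ξ h)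
  have e1 : ∑ ξ ∈ box n (2 ^ (j + 1)), ‖if ξ ∈ s ∧ dyadicCutoff j ξ ≠ 0 then c ξ else 0‖ ^ 2 =
      ∑ ξ ∈ s with dyadicCutoff j ξ ≠ 0, ‖c ξ‖ ^ 2 := by
    rw [← Finset.sum_subset hsub]
    · exact Finset.sum_congr rfl fun ξ hξ => by rw [if_pos (Finset.mem_filter.1 hξ)]
    · intro ξ _ hξ
      rw [if_neg fun h => hξ (Finset.mem_filter.2 h)]; simp
  have e2 : ∀ x, ∑ ξ ∈ box n (2 ^ (j + 1)), (dyadicCutoff j ξ : ℂ) * σ x ξ *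
      (if ξ ∈ s ∧ dyadicCutoff j ξ ≠ 0 then c ξ else 0) * (hermiteFun ξ x : ℂ) =
      ∑ ξ ∈ s, (dyadicCutoff j ξ : ℂ) * c ξ * (σ x ξ * (hermiteFun ξ x : ℂ)) := fun x => by
    rw [← Finset.sum_subset hsub, ← Finset.sum_subset
      (Finset.filter_subset (fun ξ => dyadicCutoff j ξ ≠ 0) s)]
    · refine Finset.sum_congr rfl fun ξ hξ => ?_
      rw [if_pos (Finset.mem_filter.1 hξ)]; ring
    · intro ξ h1 h2
      have : dyadicCutoff j ξ = 0 := by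
        by_contra h; exact h2 (Finset.mem_filter.2 ⟨h1, h⟩)
      simp [this]
    · intro ξ _ hξ
      rw [if_neg fun h => hξ (Finset.mem_filter.2 h)]; simp
  rw [e1] at key
  simp_rw [e2] at key
  exact key

/-! ### Decay of the Gram matrix -/

/-- For `⟨η⟩ ≥ 2⟨ξ⟩`, integrating by parts `N` times gains `⟨η⟩^{-1/2}` each time, and costs the
derivative bound `⟨η⟩^{δ/2}` of the symbol. -/
theorem exists_gram_decay {N : ℕ} {δ A : ℝ} (hδ : 0 ≤ δ) {σ : Rn n → MIdx n → ℂ}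
    (hσ : ∀ ξ, DerivBound N (fun x => σ x ξ) A ((1 + (ξ.len : ℝ)) ^ (δ / 2))) : ∃ C : ℝ, 0 ≤ C ∧
      ∀ ξ η : MIdx n, 2 * (1 + (ξ.len : ℝ)) ≤ 1 + η.len →
        ‖∫ x, star (σ x ξ * (hermiteFun ξ x : ℂ)) * (σ x η * (hermiteFun η x : ℂ))‖ ≤
          C * (1 + (η.len : ℝ)) ^ (-(N * (1 - δ) / 2)) := by
  have hA : 0 ≤ A := (hσ 0).nonneg
  set p : ℝ := N * (1 - δ) / 2 with hp
  refine ⟨2 ^ N * (A * A) * (8 * n) ^ N + A * A * max 1 ((4 * N : ℝ) ^ p), by positivity,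
    fun ξ η hlen => ?_⟩
  set t : ℝ := 1 + η.len with ht
  have ht1 : 1 ≤ t := by rw [ht]; linarith [(Nat.cast_nonneg η.len : (0 : ℝ) ≤ _)]
  have ht0 : 0 < t := by linarith
  have hξ0 : (0 : ℝ) ≤ ξ.len := Nat.cast_nonneg _
  set I := ∫ x, (star (σ x ξ) * σ x η) * ((hermiteE ξ x * hermiteE η x : ℝ) : ℂ) with hI
  have hS : 0 < Real.sqrt (hermiteNormSq ξ) * Real.sqrt (hermiteNormSq η) :=
    mul_pos (Real.sqrt_pos.2 (hermiteNormSq_pos ξ)) (Real.sqrt_pos.2 (hermiteNormSq_pos η))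
  have e : ‖∫ x, star (σ x ξ * (hermiteFun ξ x : ℂ)) * (σ x η * (hermiteFun η x : ℂ))‖ =
      ‖I‖ / (Real.sqrt (hermiteNormSq ξ) * Real.sqrt (hermiteNormSq η)) := by
    have e1 : ∀ x, star (σ x ξ * (hermiteFun ξ x : ℂ)) * (σ x η * (hermiteFun η x : ℂ)) =
        (((Real.sqrt (hermiteNormSq ξ) * Real.sqrt (hermiteNormSq η))⁻¹ : ℝ) : ℂ) *
        ((star (σ x ξ) * σ x η) * ((hermiteE ξ x * hermiteE η x : ℝ) : ℂ)) := fun x => by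
      rw [hermiteFun_eq, hermiteFun_eq, star_mul', Complex.star_def,
        Complex.conj_ofReal]
      push_cast
      rw [mul_inv]
      ring
    simp_rw [e1]
    rw [integral_const_mul, norm_mul, Complex.norm_real, Real.norm_of_nonneg (inv_nonneg.2 hS.le),
      ← hI, inv_mul_eq_div]
  rw [e, div_le_iff₀ hS]
  have hR1 : (1 + (ξ.len : ℝ)) ^ (δ / 2) ≤ t ^ (δ / 2) :=
    Real.rpow_le_rpow (by positivity) (by linarith) (by positivity)
  have hab : DerivBound N (fun x => star (σ x ξ) * σ x η) (2 ^ N * (A * A)) (t ^ (δ / 2)) :=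
    (((hσ ξ).star.mono le_rfl hR1 (by positivity))).mul (hσ η)
  -- If `t < 4N`, the gap may be too small for `N` steps, but then powers of `t` are harmless.
  by_cases hN : 4 * (N : ℝ) ≤ t
  · have h := norm_integral_mul_hermiteE_decay N (G := t / 4) (L := 2 * t) (ξ := ξ) (η := η) hab
      (by positivity) (by positivity) (by linarith) (by linarith) (by linarith)
    refine h.trans (mul_le_mul_of_nonneg_right ?_ hS.le)
    have hX : n * t ^ (δ / 2) * Real.sqrt (2 * (2 * t)) / (t / 4) =
        8 * n * t ^ (-((1 - δ) / 2)) := by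
      have h4 : Real.sqrt (2 * (2 * t)) = 2 * t ^ (1 / 2 : ℝ) := by
        rw [← Real.sqrt_eq_rpow, show 2 * (2 * t) = 2 ^ 2 * t by ring,
          Real.sqrt_mul (by norm_num), Real.sqrt_sq (by norm_num)]
      have h5 : t ^ (-((1 - δ) / 2)) * t = t ^ (δ / 2) * t ^ (1 / 2 : ℝ) := by
        rw [← Real.rpow_add ht0]
        nth_rewrite 2 [← Real.rpow_one t]
        rw [← Real.rpow_add ht0]; congr 1; ring
      rw [h4, div_eq_iff (by positivity)]
      linear_combination -2 * n * h5
    have hpow : (t ^ (-((1 - δ) / 2))) ^ N = t ^ (-p) := by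
      rw [← Real.rpow_natCast, ← Real.rpow_mul ht0.le]; congr 1; rw [hp]; ring
    rw [hX, mul_pow, hpow, ← mul_assoc]
    gcongr
    exact le_add_of_nonneg_right (by positivity)
  · have h := norm_integral_mul_hermiteE_le (a := fun x => star (σ x ξ) * σ x η) (A := A * A)
      (fun x => by
        rw [norm_mul, norm_star]
        exact mul_le_mul ((hσ ξ).norm_le x) ((hσ η).norm_le x) (norm_nonneg _) hA) ξ η
    refine h.trans (mul_le_mul_of_nonneg_right ?_ hS.le)
    rw [not_le] at hN
    have hp1 : 1 ≤ max 1 ((4 * N : ℝ) ^ p) * t ^ (-p) := by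
      rw [Real.rpow_neg ht0.le, ← div_eq_mul_inv, le_div_iff₀ (by positivity), one_mul]
      rcases le_total 0 p with h0 | h0
      · exact (Real.rpow_le_rpow ht0.le hN.le h0).trans (le_max_right _ _)
      · exact (Real.rpow_le_one_of_one_le_of_nonpos ht1 h0).trans (le_max_left _ _)
    rw [add_mul, mul_assoc (A * A)]
    exact (le_mul_of_one_le_right (by positivity) hp1).trans
      (le_add_of_nonneg_left (by positivity))

/-- Since `1 + |ξ| ≥ 1 + ξᵢ` for each `i`, the terms are dominated by products of one-dimensional
terms with the exponent `p / n > 1`. -/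
lemma exists_sum_rpow_len_le (hn : 1 ≤ n) {p : ℝ} (hp : n < p) :
    ∃ C : ℝ, 0 ≤ C ∧ ∀ s : Finset (MIdx n), ∑ ξ ∈ s, (1 + (ξ.len : ℝ)) ^ (-p) ≤ C := by
  have hn0 : (0 : ℝ) < n := by exact_mod_cast hn
  have hp0 : 0 < p := hn0.trans hp
  set q : ℝ := p / n with hq
  have hq1 : 1 < q := by rw [hq, lt_div_iff₀ hn0]; linarith
  have hsum : Summable fun k : ℕ => (1 + (k : ℝ)) ^ (-q) := by
    have h := (summable_nat_add_iff 1).2 (Real.summable_nat_rpow (p := -q) |>.2 (by linarith))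
    refine h.congr fun k => ?_
    push_cast; rw [add_comm]
  refine ⟨(∑' k : ℕ, (1 + (k : ℝ)) ^ (-q)) ^ n,
    pow_nonneg (tsum_nonneg fun k => by positivity) n, fun s => ?_⟩
  set M := s.sup MIdx.len with hM
  have hsub : s ⊆ box n M := fun ξ hξ => mem_box.2 fun i =>
    (le_len ξ i).trans (Finset.le_sup (f := MIdx.len) hξ)
  have hterm : ∀ ξ : MIdx n, (1 + (ξ.len : ℝ)) ^ (-p) ≤ ∏ i, (1 + (ξ i : ℝ)) ^ (-q) := fun ξ => by
    have e : (1 + (ξ.len : ℝ)) ^ (-p) = ∏ _i : Fin n, (1 + (ξ.len : ℝ)) ^ (-q) := by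
      rw [Finset.prod_const, Finset.card_univ, Fintype.card_fin, ← Real.rpow_natCast,
        ← Real.rpow_mul (by positivity)]
      congr 1; rw [hq]; field_simp
    rw [e]
    refine Finset.prod_le_prod (fun i _ => by positivity) fun i _ => ?_
    refine Real.rpow_le_rpow_of_nonpos (by positivity) ?_ (by linarith)
    have : (ξ i : ℝ) ≤ ξ.len := by exact_mod_cast le_len ξ i
    linarith
  calc ∑ ξ ∈ s, (1 + (ξ.len : ℝ)) ^ (-p) ≤ ∑ ξ ∈ box n M, ∏ i, (1 + (ξ i : ℝ)) ^ (-q) :=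
        (Finset.sum_le_sum fun ξ _ => hterm ξ).trans
          (Finset.sum_le_sum_of_subset_of_nonneg hsub fun ξ _ _ =>
            Finset.prod_nonneg fun i _ => by positivity)
    _ = ∏ _i : Fin n, ∑ k ∈ Finset.range (M + 1), (1 + (k : ℝ)) ^ (-q) :=
        Finset.sum_prod_piFinset (Finset.range (M + 1)) (fun _ (k : ℕ) => (1 + (k : ℝ)) ^ (-q))
    _ ≤ ∏ _i : Fin n, ∑' k : ℕ, (1 + (k : ℝ)) ^ (-q) :=
        Finset.prod_le_prod (fun i _ => Finset.sum_nonneg fun k _ => by positivity)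
          fun i _ => hsum.sum_le_tsum _ fun k _ => by positivity
    _ = _ := by simp

/-! ### Summing almost orthogonal blocks -/

/-- An almost-orthogonality principle in a Hilbert space: a family `v` whose blocks, cut out by a
partition of unity `χ`, satisfy a uniform Bessel inequality, and whose Gram matrix between distant
blocks is dominated by a square summable product `g ⊗ g`, satisfies a Bessel inequality. -/
theorem exists_norm_sq_sum_le {ι H : Type*} [NormedAddCommGroup H]
    [InnerProductSpace ℂ H] (v : ι → H) (χ : ℕ → ι → ℝ) (g : ι → ℝ) {B C D E : ℝ} (hB : 0 ≤ B)
    (hC : 0 ≤ C) (hD : 0 ≤ D) (hE : 0 ≤ E) (hg : ∀ ξ, 0 ≤ g ξ) (hχ : ∀ j ξ, |χ j ξ| ≤ B)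
    (hsep : ∀ i j ξ, χ i ξ ≠ 0 → χ j ξ ≠ 0 → j ≤ i + 1)
    (hone : ∀ s : Finset ι, ∃ J, ∀ ξ ∈ s, ∑ j ∈ Finset.range J, χ j ξ = 1)
    (hblock : ∀ j (s : Finset ι) (c : ι → ℂ), ‖∑ ξ ∈ s, ((χ j ξ : ℂ) * c ξ) • v ξ‖ ^ 2 ≤
      C * ∑ ξ ∈ s with χ j ξ ≠ 0, ‖c ξ‖ ^ 2)
    (hfar : ∀ i j ξ η, i + 2 < j → χ i ξ ≠ 0 → χ j η ≠ 0 →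
      ‖inner ℂ (v ξ) (v η)‖ ≤ D * (g ξ * g η))
    (hsum : ∀ s : Finset ι, ∑ ξ ∈ s, g ξ ^ 2 ≤ E) :
    ∃ C' : ℝ, 0 ≤ C' ∧ ∀ (s : Finset ι) (c : ι → ℂ),
      ‖∑ ξ ∈ s, c ξ • v ξ‖ ^ 2 ≤ C' * ∑ ξ ∈ s, ‖c ξ‖ ^ 2 := by
  refine ⟨15 * C + 9 * B ^ 2 * D * E, by positivity, fun s c => ?_⟩
  obtain ⟨J, hJ⟩ := hone s
  set T : ℕ → H := fun j => ∑ ξ ∈ s, ((χ j ξ : ℂ) * c ξ) • v ξ with hT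
  have hdec : ∑ ξ ∈ s, c ξ • v ξ = ∑ j ∈ Finset.range J, T j := by
    simp only [hT]
    rw [Finset.sum_comm]
    refine Finset.sum_congr rfl fun ξ hξ => ?_
    rw [← Finset.sum_smul, ← Finset.sum_mul]
    have : ∑ j ∈ Finset.range J, (χ j ξ : ℂ) = 1 := by exact_mod_cast hJ ξ hξ
    rw [this, one_mul]
  -- Only neighbouring cutoffs overlap.
  have hcard : ∀ ξ, ((Finset.range J).filter fun j => χ j ξ ≠ 0).card ≤ 3 := fun ξ => by
    rcases ((Finset.range J).filter fun j => χ j ξ ≠ 0).eq_empty_or_nonempty with h | ⟨i, hi⟩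
    · simp [h]
    · have hi' := (Finset.mem_filter.1 hi).2
      refine (Finset.card_le_card (t := Finset.Icc (i - 1) (i + 1)) fun j hj => ?_).trans ?_
      · have hj' := (Finset.mem_filter.1 hj).2
        have h1 := hsep i j ξ hi' hj'
        have h2 := hsep j i ξ hj' hi'
        rw [Finset.mem_Icc]; omega
      · rw [Nat.card_Icc]; omega
  have habs : ∀ ξ, ∑ j ∈ Finset.range J, |χ j ξ| ≤ 3 * B := fun ξ => by
    rw [← Finset.sum_filter_of_ne (p := fun j => χ j ξ ≠ 0) fun j _ h => abs_ne_zero.1 h]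
    refine (Finset.sum_le_card_nsmul _ _ B fun j _ => hχ j ξ).trans ?_
    rw [nsmul_eq_mul]
    have : (((Finset.range J).filter fun j => χ j ξ ≠ 0).card : ℝ) ≤ 3 := by
      exact_mod_cast hcard ξ
    gcongr
  have hTsum : ∑ j ∈ Finset.range J, ‖T j‖ ^ 2 ≤ 3 * C * ∑ ξ ∈ s, ‖c ξ‖ ^ 2 := by
    refine (Finset.sum_le_sum fun j _ => hblock j s c).trans ?_
    rw [← Finset.mul_sum, mul_comm 3 C, mul_assoc]
    refine mul_le_mul_of_nonneg_left ?_ hC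
    simp_rw [Finset.sum_filter]
    rw [Finset.sum_comm, Finset.mul_sum]
    refine Finset.sum_le_sum fun ξ _ => ?_
    rw [← Finset.sum_filter, Finset.sum_const, nsmul_eq_mul]
    have : (((Finset.range J).filter fun j => χ j ξ ≠ 0).card : ℝ) ≤ 3 := by
      exact_mod_cast hcard ξ
    gcongr
  have hfar' : ∀ i j ξ η, ¬ (i ≤ j + 2 ∧ j ≤ i + 2) → χ i ξ ≠ 0 → χ j η ≠ 0 →
      ‖inner ℂ (v ξ) (v η)‖ ≤ D * (g ξ * g η) := by
    intro i j ξ η hij hi hj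
    rcases lt_or_ge (i + 2) j with h | h
    · exact hfar i j ξ η h hi hj
    · rw [norm_inner_symm, mul_comm (g ξ)]
      exact hfar j i η ξ (by omega) hj hi
  set F : ℕ → ℕ → ℝ := fun i j => D * ((∑ ξ ∈ s, |χ i ξ| * (‖c ξ‖ * g ξ)) *
    ∑ η ∈ s, |χ j η| * (‖c η‖ * g η)) with hF
  have hpos : ∀ j, 0 ≤ ∑ ξ ∈ s, |χ j ξ| * (‖c ξ‖ * g ξ) := fun j =>
    Finset.sum_nonneg fun ξ _ => by have := hg ξ; positivity
  have hinner : ∀ i j, ‖inner ℂ (T i) (T j)‖ ≤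
      (if i ≤ j + 2 ∧ j ≤ i + 2 then (‖T i‖ ^ 2 + ‖T j‖ ^ 2) / 2 else 0) + F i j := by
    intro i j
    by_cases hij : i ≤ j + 2 ∧ j ≤ i + 2
    · rw [if_pos hij]
      have h1 := norm_inner_le_norm (𝕜 := ℂ) (T i) (T j)
      have h2 : 0 ≤ F i j := mul_nonneg hD (mul_nonneg (hpos i) (hpos j))
      nlinarith [sq_nonneg (‖T i‖ - ‖T j‖)]
    · rw [if_neg hij, zero_add]
      simp only [hT, hF]
      rw [sum_inner, Finset.sum_mul_sum, Finset.mul_sum]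
      refine norm_sum_le_of_le _ fun ξ _ => ?_
      rw [inner_sum, Finset.mul_sum]
      refine norm_sum_le_of_le _ fun η _ => ?_
      rw [inner_smul_left, inner_smul_right, norm_mul, norm_mul, RCLike.norm_conj, norm_mul,
        norm_mul, Complex.norm_real, Complex.norm_real, Real.norm_eq_abs, Real.norm_eq_abs]
      by_cases h0 : χ i ξ ≠ 0 ∧ χ j η ≠ 0
      · have := hfar' i j ξ η hij h0.1 h0.2
        calc _ ≤ |χ i ξ| * ‖c ξ‖ * (|χ j η| * ‖c η‖ * (D * (g ξ * g η))) := by gcongr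
          _ = _ := by ring
      · rw [not_and_or, not_not, not_not] at h0
        rcases h0 with h0 | h0 <;> simp [h0]
  have hnear : ∑ i ∈ Finset.range J, ∑ j ∈ Finset.range J,
      (if i ≤ j + 2 ∧ j ≤ i + 2 then (‖T i‖ ^ 2 + ‖T j‖ ^ 2) / 2 else 0) ≤
        15 * C * ∑ ξ ∈ s, ‖c ξ‖ ^ 2 := by
    have hhalf : ∑ i ∈ Finset.range J, ∑ j ∈ Finset.range J,
        (if i ≤ j + 2 ∧ j ≤ i + 2 then ‖T i‖ ^ 2 / 2 else 0) ≤
          5 / 2 * ∑ j ∈ Finset.range J, ‖T j‖ ^ 2 := by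
      rw [Finset.mul_sum]
      refine Finset.sum_le_sum fun i _ => ?_
      rw [← Finset.sum_filter, Finset.sum_const, nsmul_eq_mul]
      have h5 : ((Finset.range J).filter fun j => i ≤ j + 2 ∧ j ≤ i + 2).card ≤ 5 := by
        refine (Finset.card_le_card (t := Finset.Icc (i - 2) (i + 2)) fun j hj => ?_).trans ?_
        · have := (Finset.mem_filter.1 hj).2
          rw [Finset.mem_Icc]; omega
        · rw [Nat.card_Icc]; omega
      have h5' : (((Finset.range J).filter fun j => i ≤ j + 2 ∧ j ≤ i + 2).card : ℝ) ≤ 5 := by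
        exact_mod_cast h5
      nlinarith [sq_nonneg ‖T i‖]
    have hsplit : ∑ i ∈ Finset.range J, ∑ j ∈ Finset.range J,
        (if i ≤ j + 2 ∧ j ≤ i + 2 then (‖T i‖ ^ 2 + ‖T j‖ ^ 2) / 2 else 0) =
        (∑ i ∈ Finset.range J, ∑ j ∈ Finset.range J,
          (if i ≤ j + 2 ∧ j ≤ i + 2 then ‖T i‖ ^ 2 / 2 else 0)) +
        ∑ i ∈ Finset.range J, ∑ j ∈ Finset.range J,
          (if i ≤ j + 2 ∧ j ≤ i + 2 then ‖T i‖ ^ 2 / 2 else 0) := by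
      nth_rewrite 3 [Finset.sum_comm]
      rw [← Finset.sum_add_distrib]
      refine Finset.sum_congr rfl fun i _ => ?_
      rw [← Finset.sum_add_distrib]
      refine Finset.sum_congr rfl fun j _ => ?_
      by_cases h : i ≤ j + 2 ∧ j ≤ i + 2
      · rw [if_pos h, if_pos h, if_pos h.symm]; ring
      · rw [if_neg h, if_neg h, if_neg fun h' => h h'.symm]; ring
    rw [hsplit]
    linarith
  have hFsum : ∑ i ∈ Finset.range J, ∑ j ∈ Finset.range J, F i j ≤
      9 * B ^ 2 * D * E * ∑ ξ ∈ s, ‖c ξ‖ ^ 2 := by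
    simp only [hF]
    simp_rw [← Finset.mul_sum]
    rw [← Finset.sum_mul]
    have h1 : ∑ i ∈ Finset.range J, ∑ ξ ∈ s, |χ i ξ| * (‖c ξ‖ * g ξ) ≤
        3 * B * ∑ ξ ∈ s, ‖c ξ‖ * g ξ := by
      rw [Finset.sum_comm, Finset.mul_sum]
      refine Finset.sum_le_sum fun ξ _ => ?_
      rw [← Finset.sum_mul]
      exact mul_le_mul_of_nonneg_right (habs ξ) (mul_nonneg (norm_nonneg _) (hg ξ))
    have h0 : 0 ≤ ∑ i ∈ Finset.range J, ∑ ξ ∈ s, |χ i ξ| * (‖c ξ‖ * g ξ) :=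
      Finset.sum_nonneg fun i _ => hpos i
    have h2 := h0.trans h1
    have hcs := Finset.sum_mul_sq_le_sq_mul_sq s (fun ξ => ‖c ξ‖) g
    have hc0 : 0 ≤ ∑ ξ ∈ s, ‖c ξ‖ ^ 2 := Finset.sum_nonneg fun _ _ => by positivity
    calc _ ≤ D * ((3 * B * ∑ ξ ∈ s, ‖c ξ‖ * g ξ) * (3 * B * ∑ ξ ∈ s, ‖c ξ‖ * g ξ)) := by gcongr
      _ = 9 * B ^ 2 * D * (∑ ξ ∈ s, ‖c ξ‖ * g ξ) ^ 2 := by ring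
      _ ≤ 9 * B ^ 2 * D * ((∑ ξ ∈ s, ‖c ξ‖ ^ 2) * E) := by
          refine mul_le_mul_of_nonneg_left (hcs.trans ?_) (by positivity)
          exact mul_le_mul_of_nonneg_left (hsum s) hc0
      _ = _ := by ring
  have hsq : ‖∑ j ∈ Finset.range J, T j‖ ^ 2 ≤
      ∑ i ∈ Finset.range J, ∑ j ∈ Finset.range J, ‖inner ℂ (T i) (T j)‖ := by
    have h : ‖∑ j ∈ Finset.range J, T j‖ ^ 2 =
        ‖inner ℂ (∑ j ∈ Finset.range J, T j) (∑ j ∈ Finset.range J, T j)‖ := by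
      rw [inner_self_eq_norm_sq_to_K]; simp
    rw [h, sum_inner]
    refine norm_sum_le_of_le _ fun i _ => ?_
    rw [inner_sum]
    exact norm_sum_le _ _
  rw [hdec]
  calc _ ≤ _ := hsq
    _ ≤ ∑ i ∈ Finset.range J, ∑ j ∈ Finset.range J,
        ((if i ≤ j + 2 ∧ j ≤ i + 2 then (‖T i‖ ^ 2 + ‖T j‖ ^ 2) / 2 else 0) + F i j) :=
        Finset.sum_le_sum fun i _ => Finset.sum_le_sum fun j _ => hinner i j
    _ ≤ _ := by
        simp_rw [Finset.sum_add_distrib]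
        rw [add_mul]
        exact add_le_add hnear hFsum

/-! ### Estimates contained in the symbol class -/

lemma foldr_partialDiff_single (i : Fin n) (l : ℕ) (L : List (Fin n)) (hL : L.Nodup)
    (g : MIdx n → ℂ) :
    L.foldr (fun j g => (partialDiff j)^[(Pi.single i l : MIdx n) j] g) g =
      if i ∈ L then (partialDiff i)^[l] g else g := by
  induction L with
  | nil => simp
  | cons j L ih =>
    obtain ⟨hj, hL⟩ := List.nodup_cons.1 hL
    rw [List.foldr_cons, ih hL]
    by_cases hij : j = i
    · subst hij; simp [hj]
    · simp [hij, Ne.symm hij]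

lemma multiDiff_single (i : Fin n) (l : ℕ) (g : MIdx n → ℂ) :
    multiDiff (Pi.single i l) g = (partialDiff i)^[l] g := by
  rw [multiDiff, foldr_partialDiff_single i l _ (List.nodup_finRange n)]
  simp

lemma multiDiff_zero (g : MIdx n → ℂ) : multiDiff 0 g = g := by
  unfold multiDiff
  induction List.finRange n with
  | nil => rfl
  | cons j l ih => simp

lemma IsSymbol.exists_diffBound {δ : ℝ} {K N : ℕ} {σ : Rn n → MIdx n → ℂ}
    (hσ : IsSymbol 0 1 δ (K : ℕ∞) (N : ℕ∞) σ) : ∃ A : ℝ, ∀ x i, DiffBound i K 0 (σ x) A := by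
  have h : ∀ (i : Fin n) (l : ℕ), ∃ C : ℝ, 0 ≤ C ∧ (l ≤ K → ∀ x ξ,
      ‖(partialDiff i)^[l] (σ x) ξ‖ ≤ C / (1 + (ξ.len : ℝ)) ^ l) := by
    intro i l
    by_cases hl : l ≤ K
    · have hlen : MIdx.len (Pi.single i l : MIdx n) = l := by simp [MIdx.len]
      obtain ⟨C, hC, hb⟩ := hσ.bound 0 (Pi.single i l) (by simp [MIdx.len])
        (by rw [hlen]; exact_mod_cast hl)
      refine ⟨C, hC.le, fun _ x ξ => ?_⟩
      have := hb x ξ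
      rw [multiDeriv_zero, multiDiff_single, hlen] at this
      refine this.trans_eq ?_
      have e : (0 : ℝ) / 2 - 1 * (l : ℝ) + δ / 2 * (MIdx.len (0 : MIdx n) : ℝ) = -(l : ℝ) := by
        simp [MIdx.len]
      rw [e, Real.rpow_neg (by positivity), Real.rpow_natCast, ← div_eq_mul_inv]
    · exact ⟨0, le_rfl, fun h => absurd h hl⟩
  choose C hC0 hC using h
  refine ⟨∑ i, ∑ l ∈ Finset.range (K + 1), C i l, fun x i l hl ξ => ?_⟩
  rw [zero_add]
  refine (hC i l hl x ξ).trans (div_le_div_of_nonneg_right ?_ (by positivity))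
  exact (Finset.single_le_sum (f := C i) (fun l _ => hC0 i l)
    (Finset.mem_range.2 (by omega))).trans
      (Finset.single_le_sum (f := fun i => ∑ l ∈ Finset.range (K + 1), C i l)
        (fun i _ => Finset.sum_nonneg fun l _ => hC0 i l) (Finset.mem_univ i))

lemma IsSymbol.exists_derivBound {δ : ℝ} {K N : ℕ} {σ : Rn n → MIdx n → ℂ}
    (hσ : IsSymbol 0 1 δ (K : ℕ∞) (N : ℕ∞) σ) :
    ∃ A : ℝ, ∀ ξ, DerivBound N (fun x => σ x ξ) A ((1 + (ξ.len : ℝ)) ^ (δ / 2)) := by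
  have h : ∀ ν : MIdx n, ∃ C : ℝ, 0 ≤ C ∧ (ν.len ≤ N → ∀ ξ x,
      ‖multiDeriv ν (fun y => σ y ξ) x‖ ≤ C * ((1 + (ξ.len : ℝ)) ^ (δ / 2)) ^ ν.len) := by
    intro ν
    by_cases hν : ν.len ≤ N
    · obtain ⟨C, hC, hb⟩ := hσ.bound ν 0 (by exact_mod_cast hν) (by simp [MIdx.len])
      refine ⟨C, hC.le, fun _ ξ x => ?_⟩
      have := hb x ξ
      simp_rw [multiDiff_zero] at this
      refine this.trans_eq ?_
      have e : (0 : ℝ) / 2 - 1 * (MIdx.len (0 : MIdx n) : ℝ) + δ / 2 * (ν.len : ℝ) =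
        δ / 2 * (ν.len : ℝ) := by simp [MIdx.len]
      rw [e, Real.rpow_mul (by positivity), Real.rpow_natCast]
    · exact ⟨0, le_rfl, fun h => absurd h hν⟩
  choose C hC0 hC using h
  refine ⟨∑ ν ∈ box n N, C ν, fun ξ => DerivBound.of_multiDeriv (hσ.contDiff ξ) fun ν hν x => ?_⟩
  refine (hC ν hν ξ x).trans (mul_le_mul_of_nonneg_right ?_ (by positivity))
  exact Finset.single_le_sum (f := C) (fun ν _ => hC0 ν)
    (mem_box.2 fun i => (le_len ν i).trans hν)

/-! ### The operator on `L²` -/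

lemma ofReal_norm_sq_Lp (F : Lp ℂ 2 (volume : Measure (Rn n))) :
    ENNReal.ofReal (‖F‖ ^ 2) = ∫⁻ x, ‖F x‖ₑ ^ 2 := by
  rw [ENNReal.ofReal_pow (norm_nonneg _), ofReal_norm, Lp.enorm_def,
    eLpNorm_eq_lintegral_rpow_enorm_toReal (by norm_num) (by norm_num)]
  rw [← ENNReal.rpow_natCast, ← ENNReal.rpow_mul]
  simp

lemma coeFn_sum_smul_toLp {ι : Type*} (s : Finset ι) (a : ι → ℂ) {u : ι → Rn n → ℂ}
    (hu : ∀ k, MemLp (u k) 2 volume) :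
    ⇑(∑ k ∈ s, a k • (hu k).toLp (u k)) =ᵐ[volume] fun x => ∑ k ∈ s, a k * u k x := by
  classical
  induction s using Finset.induction_on with
  | empty =>
    simp only [Finset.sum_empty]
    exact Lp.coeFn_zero ℂ 2 (volume : Measure (Rn n))
  | insert k s hk ih =>
    rw [Finset.sum_insert hk]
    filter_upwards [Lp.coeFn_add (a k • (hu k).toLp (u k)) (∑ k ∈ s, a k • (hu k).toLp (u k)), ih,
      Lp.coeFn_smul (a k) ((hu k).toLp (u k)), (hu k).coeFn_toLp] with x h1 h2 h3 h4
    rw [h1, Pi.add_apply, h2, h3, Pi.smul_apply, h4, Finset.sum_insert hk, smul_eq_mul]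

lemma memLp_hermiteFun (ξ : MIdx n) : MemLp (fun x => (hermiteFun ξ x : ℂ)) 2 volume := by
  refine MemLp.ofReal ((memLp_two_iff_integrable_sq
    (continuous_hermiteFun ξ).aestronglyMeasurable).2 ?_)
  have := (integrable_hermiteE_mul ξ ξ).const_mul ((Real.sqrt (hermiteNormSq ξ))⁻¹ ^ 2)
  refine this.congr (Eventually.of_forall fun x => ?_)
  simp only [hermiteFun_eq]; ring

lemma memLp_mul_hermiteFun {a : Rn n → ℂ} {A : ℝ} (hc : Continuous a) (hA : ∀ x, ‖a x‖ ≤ A)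
    (ξ : MIdx n) : MemLp (fun x => a x * (hermiteFun ξ x : ℂ)) 2 volume := by
  refine (memLp_hermiteFun ξ).of_le_mul (c := A)
    (hc.mul (Complex.continuous_ofReal.comp (continuous_hermiteFun ξ))).aestronglyMeasurable
    (Eventually.of_forall fun x => ?_)
  rw [norm_mul]
  exact mul_le_mul_of_nonneg_right (hA x) (norm_nonneg _)

lemma inner_toLp_eq {u w : Rn n → ℂ} (hu : MemLp u 2 volume) (hw : MemLp w 2 volume) :
    inner ℂ (hu.toLp u) (hw.toLp w) = ∫ x, star (u x) * w x := by
  rw [L2.inner_def]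
  refine integral_congr_ae ?_
  filter_upwards [hu.coeFn_toLp, hw.coeFn_toLp] with x h1 h2
  rw [h1, h2, RCLike.inner_apply, mul_comm]; rfl

lemma inner_hermiteFun_toLp (f : Lp ℂ 2 (volume : Measure (Rn n))) (ξ : MIdx n) :
    inner ℂ ((memLp_hermiteFun ξ).toLp _) f = hermiteCoeff f ξ := by
  rw [L2.inner_def, hermiteCoeff]
  refine integral_congr_ae ?_
  filter_upwards [(memLp_hermiteFun ξ).coeFn_toLp] with x h1
  rw [h1, RCLike.inner_apply]
  simp

lemma orthonormal_hermiteFun_toLp :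
    Orthonormal ℂ fun ξ : MIdx n => (memLp_hermiteFun ξ).toLp (fun x => (hermiteFun ξ x : ℂ)) := by
  classical
  rw [orthonormal_iff_ite]
  intro ξ η
  rw [inner_toLp_eq]
  have e : ∀ x, star (hermiteFun ξ x : ℂ) * (hermiteFun η x : ℂ) =
      (((Real.sqrt (hermiteNormSq ξ))⁻¹ * (Real.sqrt (hermiteNormSq η))⁻¹ *
        (hermiteE ξ x * hermiteE η x) : ℝ) : ℂ) := fun x => by
    rw [Complex.star_def, Complex.conj_ofReal, hermiteFun_eq, hermiteFun_eq]
    push_cast; ring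
  simp_rw [e]
  rw [integral_complex_ofReal, integral_const_mul, integral_hermiteE_mul]
  by_cases h : ξ = η
  · subst h
    have hN := hermiteNormSq_pos ξ
    rw [if_pos rfl, if_pos rfl, ← mul_inv, Real.mul_self_sqrt hN.le, inv_mul_cancel₀ hN.ne',
      Complex.ofReal_one]
  · rw [if_neg h, if_neg h, mul_zero, Complex.ofReal_zero]

/-- Expanding in an orthonormal family and replacing its members by those of a family that
satisfies a Bessel inequality gives a bounded operator, defined by unconditionally convergent
series. -/
theorem exists_clm_hasSum {ι H : Type*} [NormedAddCommGroup H] [InnerProductSpace ℂ H]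
    [CompleteSpace H] {e v : ι → H} (he : Orthonormal ℂ e) {C : ℝ} (hC : 0 ≤ C)
    (hv : ∀ (s : Finset ι) (c : ι → ℂ), ‖∑ k ∈ s, c k • v k‖ ^ 2 ≤ C * ∑ k ∈ s, ‖c k‖ ^ 2) :
    ∃ T : H →L[ℂ] H, ∀ f, HasSum (fun k => inner ℂ (e k) f • v k) (T f) := by
  have hsum : ∀ f : H, Summable fun k => inner ℂ (e k) f • v k := by
    intro f
    refine summable_iff_vanishing_norm.2 fun ε hε => ?_
    obtain ⟨s, hs⟩ := summable_iff_vanishing_norm.1 (he.inner_products_summable f)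
      (ε ^ 2 / (C + 1)) (by positivity)
    refine ⟨s, fun t ht => ?_⟩
    have h1 := hs t ht
    rw [Real.norm_of_nonneg (Finset.sum_nonneg fun _ _ => by positivity),
      lt_div_iff₀ (by positivity)] at h1
    have h2 := hv t fun k => inner ℂ (e k) f
    have h3 : 0 ≤ ∑ k ∈ t, ‖inner ℂ (e k) f‖ ^ 2 := Finset.sum_nonneg fun _ _ => by positivity
    exact lt_of_pow_lt_pow_left₀ 2 hε.le (by nlinarith)
  refine ⟨LinearMap.mkContinuous
    { toFun := fun f => ∑' k, inner ℂ (e k) f • v k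
      map_add' := fun f g => by
        simp_rw [inner_add_right, add_smul]
        exact (hsum f).tsum_add (hsum g)
      map_smul' := fun c f => by
        simp_rw [inner_smul_right, mul_smul, RingHom.id_apply]
        exact (hsum f).tsum_const_smul c } (Real.sqrt C) fun f => ?_, fun f => (hsum f).hasSum⟩
  refine le_of_tendsto ((hsum f).hasSum.norm) (Eventually.of_forall fun s => ?_)
  refine le_of_sq_le_sq ?_ (by positivity)
  rw [mul_pow, Real.sq_sqrt hC]
  exact (hv s _).trans (mul_le_mul_of_nonneg_left (he.sum_inner_products_le f) hC)

/-- The Bessel inequality for the functions `σ(·, ξ) h_ξ` gives the bounded extension. -/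
theorem extendsBoundedlyL2_of_sum_le {σ : Rn n → MIdx n → ℂ}
    (hm : ∀ ξ, MemLp (fun x => σ x ξ * (hermiteFun ξ x : ℂ)) 2 volume) {C : ℝ} (hC : 0 ≤ C)
    (hv : ∀ (s : Finset (MIdx n)) (c : MIdx n → ℂ),
      ‖∑ ξ ∈ s, c ξ • (hm ξ).toLp _‖ ^ 2 ≤ C * ∑ ξ ∈ s, ‖c ξ‖ ^ 2) :
    ExtendsBoundedlyL2 σ := by
  obtain ⟨T, hT⟩ := exists_clm_hasSum orthonormal_hermiteFun_toLp hC hv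
  refine ⟨T, fun f => ?_⟩
  have hS := hT f
  simp_rw [inner_hermiteFun_toLp] at hS
  have hterm : ∀ s : Finset (MIdx n), (fun x => T f x - ∑ ξ ∈ s, pseudoMultTerm σ f ξ x) =ᵐ[volume]
      ⇑(T f - ∑ ξ ∈ s, hermiteCoeff f ξ • (hm ξ).toLp _) := by
    intro s
    filter_upwards [Lp.coeFn_sub (T f) (∑ ξ ∈ s, hermiteCoeff f ξ • (hm ξ).toLp _),
      coeFn_sum_smul_toLp s (hermiteCoeff f) hm] with x h1 h2
    rw [h1, Pi.sub_apply, h2]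
    congr 1
    refine Finset.sum_congr rfl fun ξ _ => ?_
    rw [pseudoMultTerm]; ring
  have hlim : Tendsto (fun s : Finset (MIdx n) =>
      eLpNorm (fun x => T f x - ∑ ξ ∈ s, pseudoMultTerm σ f ξ x) 2 volume) atTop (𝓝 0) := by
    have e : ∀ s : Finset (MIdx n),
        eLpNorm (fun x => T f x - ∑ ξ ∈ s, pseudoMultTerm σ f ξ x) 2 volume =
        ‖T f - ∑ ξ ∈ s, hermiteCoeff f ξ • (hm ξ).toLp _‖ₑ := fun s => by
      rw [eLpNorm_congr_ae (hterm s), Lp.enorm_def]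
    simp_rw [e]
    have h := (tendsto_const_nhds (x := T f)).sub hS
    rw [sub_self] at h
    simpa using h.enorm
  refine ⟨hlim, fun habs => ?_⟩
  -- Along the boxes a subsequence of the partial sums converges almost everywhere to `T f`.
  have hbox : Tendsto (fun m : ℕ => box n m) atTop atTop := by
    refine tendsto_atTop_finset_of_monotone (fun a b hab ξ hξ => mem_box.2 fun i =>
      (mem_box.1 hξ i).trans hab) fun ξ => ⟨ξ.len, mem_box.2 fun i => le_len ξ i⟩
  have hmeas : ∀ m : ℕ, AEStronglyMeasurable
      (fun x => ∑ ξ ∈ box n m, pseudoMultTerm σ f ξ x) volume := fun m => by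
    refine (Lp.aestronglyMeasurable
      (∑ ξ ∈ box n m, hermiteCoeff f ξ • (hm ξ).toLp _)).congr ?_
    filter_upwards [coeFn_sum_smul_toLp (box n m) (hermiteCoeff f) hm] with x h2
    rw [h2]
    refine Finset.sum_congr rfl fun ξ _ => ?_
    rw [pseudoMultTerm]; ring
  have hin : TendstoInMeasure volume (fun (m : ℕ) x => ∑ ξ ∈ box n m, pseudoMultTerm σ f ξ x) atTop
      (T f) := by
    refine tendstoInMeasure_of_tendsto_eLpNorm (p := 2) (by norm_num) hmeas
      (Lp.aestronglyMeasurable _) ?_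
    refine (hlim.comp hbox).congr fun m => ?_
    exact eLpNorm_sub_comm _ _ _ _
  obtain ⟨φ, hφ, hae⟩ := hin.exists_seq_tendsto_ae
  filter_upwards [habs, hae] with x h1 h2
  exact tendsto_nhds_unique h2 (h1.hasSum.comp (hbox.comp hφ.tendsto_atTop))

end HermitePM

end

open HermitePM in
theorem theorem1p2 (n : ℕ) (hn : 1 ≤ n) (δ : ℝ) (hδ0 : 0 ≤ δ) (hδ1 : δ < 1)
    (σ : HermitePM.Rn n → HermitePM.MIdx n → ℂ)
    (hσ : HermitePM.IsSymbol 0 1 δ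
      ((⌊(n : ℝ) / 2⌋₊ + 1 : ℕ) : ℕ∞) ((⌊2 * (n : ℝ) / (1 - δ)⌋₊ + 1 : ℕ) : ℕ∞) σ) :
    HermitePM.ExtendsBoundedlyL2 σ := by
  set K : ℕ := ⌊(n : ℝ) / 2⌋₊ + 1 with hK
  set N : ℕ := ⌊2 * (n : ℝ) / (1 - δ)⌋₊ + 1 with hN
  have hK2 : n < 2 * K := by
    have h := Nat.lt_floor_add_one ((n : ℝ) / 2)
    have : (n : ℝ) < (2 * K : ℕ) := by rw [hK]; push_cast; linarith
    exact_mod_cast this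
  have hN2 : (n : ℝ) < N * (1 - δ) / 2 := by
    have h := Nat.lt_floor_add_one (2 * (n : ℝ) / (1 - δ))
    rw [div_lt_iff₀ (by linarith)] at h
    rw [hN]; push_cast; linarith
  obtain ⟨A₁, hA₁⟩ := hσ.exists_diffBound
  obtain ⟨A₂, hA₂⟩ := hσ.exists_derivBound
  obtain ⟨C, hC, hblock⟩ := exists_dyadic_block_bound hn hK2 hA₁
  obtain ⟨D, hD, hgram⟩ := exists_gram_decay hδ0 hA₂
  obtain ⟨E, hE, hsum⟩ := exists_sum_rpow_len_le hn hN2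
  obtain ⟨B, hB⟩ := diffBound_dyadicCutoff n 0
  have hm : ∀ ξ, MemLp (fun x => σ x ξ * (hermiteFun ξ x : ℂ)) 2 volume := fun ξ =>
    memLp_mul_hermiteFun (hA₂ ξ).continuous (hA₂ ξ).norm_le ξ
  set p : ℝ := N * (1 - δ) / 2 with hp
  have hp0 : 0 ≤ p := (Nat.cast_nonneg n).trans hN2.le
  obtain ⟨C', hC', hmain⟩ := exists_norm_sq_sum_le (fun ξ => (hm ξ).toLp _) dyadicCutoff
    (fun ξ => (1 + (ξ.len : ℝ)) ^ (-(p / 2))) (B := B) (hB ⟨0, hn⟩ 0).nonneg hC hD hE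
    (fun ξ => by positivity)
    (fun j ξ => by simpa using (hB ⟨0, hn⟩ j).norm_le ξ)
    (fun i j ξ hi hj => by
      have h1 := (lt_of_dyadicCutoff_ne_zero hj).1
      have h2 := (lt_of_dyadicCutoff_ne_zero hi).2
      have h3 : (2 : ℝ) ^ j < 2 ^ (i + 2) := by rw [pow_add]; linarith
      have := (pow_lt_pow_iff_right₀ (one_lt_two (α := ℝ))).1 h3
      omega)
    (fun s => ⟨s.sup MIdx.len + 1, fun ξ hξ => sum_dyadicCutoff _ ξ (by
      have h1 : ξ.len ≤ s.sup MIdx.len := Finset.le_sup (f := MIdx.len) hξ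
      have h2 : s.sup MIdx.len < 2 ^ s.sup MIdx.len := Nat.lt_two_pow_self
      exact_mod_cast (by omega : 1 + ξ.len ≤ 2 ^ s.sup MIdx.len))⟩)
    (fun j s c => by
      have h0 : 0 ≤ C * ∑ ξ ∈ s with dyadicCutoff j ξ ≠ 0, ‖c ξ‖ ^ 2 :=
        mul_nonneg hC (Finset.sum_nonneg fun _ _ => by positivity)
      rw [← ENNReal.ofReal_le_ofReal_iff h0, ofReal_norm_sq_Lp]
      refine (lintegral_congr_ae ?_).trans_le (hblock j s c)
      filter_upwards [coeFn_sum_smul_toLp s (fun ξ => (dyadicCutoff j ξ : ℂ) * c ξ) hm] with x hx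
      rw [hx])
    (fun i j ξ η hij hi hj => by
      have h1 := (lt_of_dyadicCutoff_ne_zero hi).2
      have h2 := (lt_of_dyadicCutoff_ne_zero hj).1
      have h3 : (2 : ℝ) ^ (i + 3) ≤ 2 ^ j := pow_le_pow_right₀ one_le_two (by omega)
      rw [pow_add] at h3
      have h4 : 2 * (1 + (ξ.len : ℝ)) ≤ 1 + η.len := by linarith
      rw [inner_toLp_eq]
      refine (hgram ξ η h4).trans (mul_le_mul_of_nonneg_left ?_ hD)
      have e : (1 + (η.len : ℝ)) ^ (-p) =
          (1 + (η.len : ℝ)) ^ (-(p / 2)) * (1 + (η.len : ℝ)) ^ (-(p / 2)) := by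
        rw [← Real.rpow_add (by positivity)]; congr 1; ring
      rw [e]
      refine mul_le_mul_of_nonneg_right ?_ (by positivity)
      exact Real.rpow_le_rpow_of_nonpos (by positivity)
        (by linarith [(Nat.cast_nonneg ξ.len : (0 : ℝ) ≤ _)]) (by linarith))
    (fun s => by
      refine le_trans (le_of_eq (Finset.sum_congr rfl fun ξ _ => ?_)) (hsum s)
      rw [← Real.rpow_natCast, ← Real.rpow_mul (by positivity)]
      congr 1; push_cast; ring)
  exact extendsBoundedlyL2_of_sum_le hm hC' hmain
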